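/- Let $S$ be an irreducible substochastic matrix (entries $\ge 0$, row sums $\le 1$) indexed by a finite set $\Omega$. For an irreducible stochastic matrix $F$ let $\pi(F)$ be its invariant distribution, the unique solution of $\pi(F)^{\mathsf t}F=\pi(F)^{\mathsf t}$, $\sum_m\pi_m(F)=1$. Write $F\ge S$ for the entrywise inequality; every stochastic $F\ge S$ is irreducible. Let $X$ be the Markov chain on $\Omega\cup\{\omega\}$ that moves from $k\in\Omega$ to $l\in\Omega$ with probability $S_{kl}$ and to $\omega$ with probability $1-\sum_{m\in\Omega} S_{km}$, and for which $\omega$ is absorbing; let $\tau_k=\min\{s>0: X_s=k\}$, and for $i\ne j$ in $\Omega$ let $$Q_{ij}(S)=\mathbf P\bigl[\tau_j<\min\{\tau_i,\tau_\omega\}\,\big|\,X_0=i\bigr].$$ (1) For all $i\neq j$ in $\Omega$ and every $\varepsilon>0$ there exist stochastic matrices $F,\tilde F\ge S$ with $|\tilde F_{kl}-F_{kl}|=0$ for all $(k,l)$ except $(i,j)$ and $(i,i)$, such that $$\max_{m\in\Omega}\bigl|\log\pi_m(\tilde F)-\log\pi_m(F)\bigr|\ \ge\ \tfrac12\,(Q_{ij}(S)+\varepsilon)^{-1}\,|\tilde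 F_{ij}-F_{ij}|$$ and $$\tfrac12\,(Q_{ij}(S)+\varepsilon)^{-1}\,|\tilde F_{ij}-F_{ij}|\ \ge\ \bigl|\log\bigl(\tilde F_{ij}-S_{ij}+2(Q_{ij}(S)+\varepsilon)\bigr)-\log\bigl(F_{ij}-S_{ij}+2(Q_{ij}(S)+\varepsilon)\bigr)\bigr| .$$ If $\sum_m S_{im}<1$, they can moreover be chosen with $\tilde F_{ij}\ne F_{ij}$. (If $\sum_m S_{im}=1$, then all stochastic $F\ge S$ have the same $i$-th row.) (2) Hence the coefficients $Q_{ij}(S)$ are optimal up to a factor of two, in the following sense. One has $Q_{ij}(S)>0$ for all $i\ne j$, and with $\rho_{kl}=Q_{kl}(S)$ and $\eta_{kl}=Q_{kl}(S)^{-1}$ each of the bounds $$\text{(a)}\quad |\log\pi_m(\tilde F)-\log\pi_m(F)|\le\sum_{k\ne l}\bigl|\log(\tilde F_{kl}-S_{kl}+\rho_{kl})-\log(F_{kl}-S_{kl}+\rho_{kl})\bigr|,$$ $$\text{(b)}\quad |\log\pi_m(\tilde F)-\log\pi_m(F)|\le\sum_{k\ne l}\eta_{kl}\,|\tilde F_{kl}-F_{kl}|$$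 holds for all $m\in\Omega$ and all stochastic $F,\tilde F\ge S$. Conversely, let $i\neq j$ with $\sum_m S_{im}<1$. If (a) holds for all $m$ and all stochastic $F,\tilde F\ge S$ with some numbers $\rho_{kl}>0$ ($k\ne l$), then $\rho_{ij}\le 2Q_{ij}(S)$; if (b) holds for all $m$ and all stochastic $F,\tilde F\ge S$ with some real numbers $\eta_{kl}$ ($k\neq l$), then $\eta_{ij}\ge\tfrac12 Q_{ij}(S)^{-1}$. -/

import Mathlib

namespace MarkovPerturbation

/-- A matrix is substochastic if its entries are nonnegative and its row sums are at most one.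
(Stochastic matrices are the elements of `Matrix.rowStochastic`.) -/
def IsSubstochastic {Ω : Type*} [Fintype Ω] (S : Matrix Ω Ω ℝ) : Prop :=
  (∀ a b, 0 ≤ S a b) ∧ ∀ a, ∑ b, S a b ≤ 1

/-- `F` is a stochastic matrix that is entrywise bounded below by `S`. -/
def IsStochasticAbove {Ω : Type*} [Fintype Ω] [DecidableEq Ω] (S F : Matrix Ω Ω ℝ) : Prop :=
  F ∈ Matrix.rowStochastic ℝ Ω ∧ ∀ a b, S a b ≤ F a b

/-! ### The invariant distribution -/

/-- The equations `pᵀ F = pᵀ`, `pᵀ e = 1` that define the invariant distribution. -/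
def IsInvariantDist {Ω : Type*} [Fintype Ω] (F : Matrix Ω Ω ℝ) (p : Ω → ℝ) : Prop :=
  Matrix.vecMul p F = p ∧ ∑ a, p a = 1

open Classical in
/-- `invDist F` is the invariant distribution `π(F)`, the unique solution of the equations
`IsInvariantDist F`. (It is set to zero if there is no unique solution, which does not happen for
irreducible stochastic matrices, see `existsUnique_isInvariantDist`.) -/
noncomputable def invDist {Ω : Type*} [Fintype Ω] (F : Matrix Ω Ω ℝ) : Ω → ℝ :=
  if h : ∃! p : Ω → ℝ, IsInvariantDist F p then h.choose else 0

section WellDefined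

variable {Ω : Type*} [Fintype Ω] [DecidableEq Ω] {F : Matrix Ω Ω ℝ}

lemma vecMul_abs (hF : F ∈ Matrix.rowStochastic ℝ Ω) {v : Ω → ℝ}
    (hv : Matrix.vecMul v F = v) : Matrix.vecMul (fun a => |v a|) F = fun a => |v a| := by
  rw [Matrix.mem_rowStochastic_iff_sum] at hF
  have h1 : ∀ b, |v b| ≤ Matrix.vecMul (fun a => |v a|) F b := by
    intro b
    have h := congrFun hv b
    simp only [Matrix.vecMul, dotProduct] at h ⊢
    calc |v b| = |∑ a, v a * F a b| := by rw [h]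
      _ ≤ ∑ a, |v a * F a b| := Finset.abs_sum_le_sum_abs _ _
      _ = ∑ a, |v a| * F a b := by
        refine Finset.sum_congr rfl fun a _ => ?_
        rw [abs_mul, abs_of_nonneg (hF.1 a b)]
  have h2 : ∑ b, |v b| = ∑ b, Matrix.vecMul (fun a => |v a|) F b := by
    simp only [Matrix.vecMul, dotProduct]
    rw [Finset.sum_comm]
    simp_rw [← Finset.mul_sum, hF.2, mul_one]
  funext b
  exact (((Finset.sum_eq_sum_iff_of_le fun b _ => h1 b).1 h2) b (Finset.mem_univ b)).symm

lemma pos_of_vecMul (hirr : F.IsIrreducible) {v : Ω → ℝ} (h0 : ∀ a, 0 ≤ v a)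
    (hv : Matrix.vecMul v F = v) {a : Ω} (ha : 0 < v a) (b : Ω) : 0 < v b := by
  obtain ⟨k, -, hk⟩ := (Matrix.isIrreducible_iff_exists_pow_pos hirr.nonneg).1 hirr a b
  have hpow : ∀ n : ℕ, Matrix.vecMul v (F ^ n) = v := by
    intro n
    induction n with
    | zero => simp
    | succ n ih => rw [pow_succ, ← Matrix.vecMul_vecMul, ih, hv]
  have h := congrFun (hpow k) b
  simp only [Matrix.vecMul, dotProduct] at h
  rw [← h]
  exact Finset.sum_pos' (fun c _ => mul_nonneg (h0 c) (Matrix.pow_apply_nonneg hirr.nonneg k c b))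
    ⟨a, Finset.mem_univ a, mul_pos ha hk⟩

/-- An irreducible stochastic matrix has exactly one invariant distribution. -/
lemma existsUnique_isInvariantDist [Nonempty Ω] (hF : F ∈ Matrix.rowStochastic ℝ Ω)
    (hirr : F.IsIrreducible) : ∃! p : Ω → ℝ, IsInvariantDist F p := by
  -- a fixed vector with vanishing sum is zero
  have hzero : ∀ v : Ω → ℝ, Matrix.vecMul v F = v → ∑ a, v a = 0 → ∀ a, v a ≤ 0 := by
    intro v hv hs a
    by_contra hpos
    push Not at hpos
    have hw : Matrix.vecMul (v + fun a => |v a|) F = v + fun a => |v a| := by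
      rw [Matrix.add_vecMul, hv, vecMul_abs hF hv]
    have h0 : ∀ b, 0 ≤ (v + fun a => |v a|) b := fun b => by
      have := neg_abs_le (v b)
      simp only [Pi.add_apply]
      linarith
    have hall := pos_of_vecMul hirr h0 hw (a := a) (by
      have := abs_nonneg (v a)
      simp only [Pi.add_apply]
      linarith)
    have hvpos : ∀ b, 0 < v b := fun b => by
      by_contra hb
      push Not at hb
      have := hall b
      simp only [Pi.add_apply, abs_of_nonpos hb] at this
      linarith
    have := Finset.sum_pos (fun b _ => hvpos b) (Finset.univ_nonempty (α := Ω))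
    linarith
  -- a nonzero fixed vector
  have hdet : (F - 1).det = 0 := by
    refine Matrix.exists_mulVec_eq_zero_iff.1 ⟨1, one_ne_zero, ?_⟩
    rw [Matrix.sub_mulVec, hF.2, Matrix.one_mulVec, sub_self]
  obtain ⟨v, hv0, hv⟩ := Matrix.exists_vecMul_eq_zero_iff.2 hdet
  rw [Matrix.vecMul_sub, Matrix.vecMul_one, sub_eq_zero] at hv
  obtain ⟨a, ha⟩ := Function.ne_iff.1 hv0
  have hsum : 0 < ∑ b, |v b| :=
    Finset.sum_pos' (fun b _ => abs_nonneg _) ⟨a, Finset.mem_univ a, abs_pos.2 ha⟩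
  refine ⟨(∑ b, |v b|)⁻¹ • fun b => |v b|, ⟨?_, ?_⟩, ?_⟩
  · rw [Matrix.smul_vecMul, vecMul_abs hF hv]
  · simp only [Pi.smul_apply, smul_eq_mul, ← Finset.mul_sum]
    exact inv_mul_cancel₀ hsum.ne'
  · rintro q ⟨hq, hq1⟩
    set p : Ω → ℝ := (∑ b, |v b|)⁻¹ • fun b => |v b| with hp
    have hpF : Matrix.vecMul p F = p := by rw [hp, Matrix.smul_vecMul, vecMul_abs hF hv]
    have hp1 : ∑ b, p b = 1 := by
      simp only [hp, Pi.smul_apply, smul_eq_mul, ← Finset.mul_sum]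
      exact inv_mul_cancel₀ hsum.ne'
    funext b
    refine le_antisymm ?_ ?_
    · have := hzero (q - p) (by rw [Matrix.sub_vecMul, hq, hpF])
        (by simp [Finset.sum_sub_distrib, hq1, hp1]) b
      simp only [Pi.sub_apply] at this
      linarith
    · have := hzero (p - q) (by rw [Matrix.sub_vecMul, hq, hpF])
        (by simp [Finset.sum_sub_distrib, hq1, hp1]) b
      simp only [Pi.sub_apply] at this
      linarith

end WellDefined

/-! ### Markov chains on a finite state space -/

section Chain

variable {E : Type*} [Fintype E] [DecidableEq E]

/-- The distribution of the next state of a chain with transition matrix `P` which is at `a`. -/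
noncomputable def rowPMF (P : Matrix E E ℝ) (hP : P ∈ Matrix.rowStochastic ℝ E) (a : E) : PMF E :=
  PMF.ofFintype (fun b => ENNReal.ofReal (P a b)) (by
    rw [← ENNReal.ofReal_sum_of_nonneg fun b _ => hP.1 a b,
      Matrix.sum_row_of_mem_rowStochastic hP a, ENNReal.ofReal_one])

variable [MeasurableSpace E] [MeasurableSingletonClass E]

/-- The transition kernel from the states at times `0, …, n` to the state at time `n + 1`. -/
noncomputable def stepKernel (P : Matrix E E ℝ) (hP : P ∈ Matrix.rowStochastic ℝ E) (n : ℕ) :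
    ProbabilityTheory.Kernel (Finset.Iic n → E) E :=
  ProbabilityTheory.Kernel.ofFunOfCountable fun x =>
    (rowPMF P hP (x ⟨n, Finset.mem_Iic.2 le_rfl⟩)).toMeasure

instance (P : Matrix E E ℝ) (hP : P ∈ Matrix.rowStochastic ℝ E) (n : ℕ) :
    ProbabilityTheory.IsMarkovKernel (stepKernel P hP n) :=
  ⟨fun _ => PMF.toMeasure.isProbabilityMeasure _⟩

/-- The law, on the space of trajectories `ℕ → E`, of the Markov chain with transition matrix `P`
started at `x` (given by the Ionescu-Tulcea theorem). -/
noncomputable def chainLaw (P : Matrix E E ℝ) (hP : P ∈ Matrix.rowStochastic ℝ E) (x : E) :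
    MeasureTheory.Measure (ℕ → E) :=
  ProbabilityTheory.Kernel.traj (X := fun _ => E) (stepKernel P hP) 0 fun _ => x

end Chain

/-- The first return time `τ_k = min {s > 0 : X_s = k}` of a trajectory (`⊤` if there is none). -/
noncomputable def returnTime {E : Type*} (k : E) (X : ℕ → E) : WithTop ℕ :=
  MeasureTheory.hittingAfter (fun s (Y : ℕ → E) => Y s) {k} 1 X

/-! ### The coefficients `Q_ij(S)` -/

section Coefficients

variable {Ω : Type*} [Fintype Ω]

/-- The transition matrix `S^ω` on `Ω ∪ {ω}`, where the absorbing state `ω` is `none`. -/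
def augmented (S : Matrix Ω Ω ℝ) : Matrix (Option Ω) (Option Ω) ℝ
  | some a, some b => S a b
  | some a, none => 1 - ∑ b, S a b
  | none, some _ => 0
  | none, none => 1

lemma augmented_mem [DecidableEq Ω] {S : Matrix Ω Ω ℝ} (hS : IsSubstochastic S) :
    augmented S ∈ Matrix.rowStochastic ℝ (Option Ω) := by
  rw [Matrix.mem_rowStochastic_iff_sum]
  refine ⟨?_, ?_⟩
  · rintro (_ | a) (_ | b)
    · exact zero_le_one
    · exact le_rfl
    · exact sub_nonneg.2 (hS.2 a)
    · exact hS.1 a b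
  · rintro (_ | a) <;> simp [Fintype.sum_option, augmented]

/-- `Q_ij(S) = P_i[τ_j < min {τ_i, τ_ω}](S^ω)`: the probability that the chain with transition
matrix `S^ω` started at `i` hits `j` before it returns to `i` and before it is absorbed in `ω`. -/
noncomputable def Q [DecidableEq Ω] (S : Matrix Ω Ω ℝ) (hS : IsSubstochastic S) (i j : Ω) : ℝ :=
  letI : MeasurableSpace (Option Ω) := ⊤
  (chainLaw (augmented S) (augmented_mem hS) (some i)).real
    {X | returnTime (some j) X < min (returnTime (some i) X) (returnTime none X)}

end Coefficients

/-! ### Error bounds for the invariant distribution -/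

section Bounds

variable {Ω : Type*} [Fintype Ω] [DecidableEq Ω]

/-- The bound `|log π_m(G) - log π_m(F)| ≤ ∑_{k ≠ l} |log (G_kl - S_kl + ρ_kl) - log (F_kl - S_kl +
ρ_kl)|` holds for all states `m` and all stochastic `F, G ≥ S`. -/
def LogBound (S ρ : Matrix Ω Ω ℝ) : Prop :=
  ∀ F G : Matrix Ω Ω ℝ, IsStochasticAbove S F → IsStochasticAbove S G → ∀ m,
    |Real.log (invDist G m) - Real.log (invDist F m)| ≤
      ∑ k, ∑ l with l ≠ k,
        |Real.log (G k l - S k l + ρ k l) - Real.log (F k l - S k l + ρ k l)|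

/-- The bound `|log π_m(G) - log π_m(F)| ≤ ∑_{k ≠ l} η_kl |G_kl - F_kl|` holds for all states `m`
and all stochastic `F, G ≥ S`. -/
def LinearBound (S η : Matrix Ω Ω ℝ) : Prop :=
  ∀ F G : Matrix Ω Ω ℝ, IsStochasticAbove S F → IsStochasticAbove S G → ∀ m,
    |Real.log (invDist G m) - Real.log (invDist F m)| ≤
      ∑ k, ∑ l with l ≠ k, η k l * |G k l - F k l|

end Bounds

end MarkovPerturbation

open MarkovPerturbation

/-! The probabilistic coefficient becomes algebraic through the Dirichlet problem. If `h` is the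
probability of reaching `j` before `i` and before killing, then `Q S hS i j = ∑ b, S i b * h b`
(`Q_eq_sum`). This expression is positive and monotone in the matrix. For stochastic `F ≥ S` and `k
≠ l`, the same expression `q` formed with `F` satisfies `q ≥ F k l - S k l + Q S hS k l`
(`IsHittingProb.sum_le_sum`), since extra mass on `(k, l)` leads straight to the target.

For the upper bounds, write `p` for `invDist F`. Hitting probabilities of the time-reversed chain,
weighted by `p`, give a zero-sum vector `z` with `|z m| ≤ p m` and `z - z F = p k * q * (e_k - e_l)`
(`exists_green`). Superposing these vectors gives an exact formula for `invDist G - invDist F`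
(`exists_perturbation_formula`). Applied along the segment from `F` to `G`, it bounds the
logarithmic derivative of each `invDist` entry by `∑ |G k l - F k l| / (x k l)`, where `x k l` is
the current entry minus `S k l` plus `Q S hS k l`. Integration gives the logarithmic bound
(`logBound_Q`), and the Lipschitz estimate for `log` gives the linear one.

For optimality, `F` sends all killed mass to `i`, and `G` moves mass `t ≤ ε` from `(i, i)` to `(i,
j)`. A balance identity shows that the ratio of the masses at `j` and `i` is multiplied by `(Q + t)
/ Q`. Its logarithm changes by at least `t / (Q + ε)`, so one of the two log-masses changes by at
least half of that (`exists_sharp`). This halving is the source of the factor two. The converse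
statements compare this pair with the assumed bounds and let `ε` tend to zero. -/

namespace MarkovPerturbation

/-! ### Taboo probabilities and first entrance times -/

section Chain

open MeasureTheory ProbabilityTheory Preorder

variable {E : Type*} [MeasurableSpace E] [MeasurableSingletonClass E]

lemma measurableSet_eval_eq {ι : Type*} (s : ι) (b : E) :
    MeasurableSet {y : ι → E | y s = b} :=
  measurable_pi_apply (X := fun _ => E) s (measurableSet_singleton b)

lemma measurableSet_eval_notMem {ι : Type*} (s : ι) (K : Finset E) :
    MeasurableSet {y : ι → E | y s ∉ K} :=
  measurable_pi_apply (X := fun _ => E) s K.finite_toSet.measurableSet.compl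

lemma measurableSet_taboo (K : Finset E) (n : ℕ) (b : E) :
    MeasurableSet {X : ℕ → E | X (n + 1) = b ∧ ∀ s, 1 ≤ s → s ≤ n → X s ∉ K} := by
  refine (measurableSet_eval_eq (n + 1) b).inter
    (s₂ := {X : ℕ → E | ∀ s, 1 ≤ s → s ≤ n → X s ∉ K}) ?_
  simp only [Set.ofPred_forall]
  refine MeasurableSet.iInter fun s => MeasurableSet.iInter fun _ => MeasurableSet.iInter fun _ => ?_
  exact measurableSet_eval_notMem s K

variable [Fintype E] [DecidableEq E]

instance (P : Matrix E E ℝ) (hP : P ∈ Matrix.rowStochastic ℝ E) (x : E) :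
    IsProbabilityMeasure (chainLaw P hP x) := by
  unfold chainLaw; infer_instance

/-- The Markov property, for events that determine the present state. -/
lemma chainLaw_inter_next (P : Matrix E E ℝ) (hP : P ∈ Matrix.rowStochastic ℝ E) (x : E) (n : ℕ)
    (a b : E) {D : Set (Finset.Iic n → E)} (hD : MeasurableSet D)
    (hDa : ∀ y ∈ D, y ⟨n, Finset.mem_Iic.2 le_rfl⟩ = a) :
    (chainLaw P hP x).real {X | frestrictLe n X ∈ D ∧ X (n + 1) = b} =
      (chainLaw P hP x).real {X | frestrictLe n X ∈ D} * P a b := by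
  have h1 := Kernel.partialTraj_compProd_eq_map_traj (X := fun _ => E) (κ := stepKernel P hP) (Nat.zero_le n)
    (x₀ := (fun _ => x : Finset.Iic 0 → E))
  have hm : Measurable fun X : ℕ → E => (frestrictLe (π := fun _ => E) n X, X (n + 1)) := by
    fun_prop
  have h2 : chainLaw P hP x {X | frestrictLe n X ∈ D ∧ X (n + 1) = b} =
      (Kernel.partialTraj (X := fun _ => E) (stepKernel P hP) 0 n (fun _ => x) ⊗ₘ stepKernel P hP n) (D ×ˢ {b}) := by
    rw [h1, Measure.map_apply hm (hD.prod (measurableSet_singleton b))]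
    rfl
  have h3 : chainLaw P hP x {X | frestrictLe n X ∈ D} =
      Kernel.partialTraj (X := fun _ => E) (stepKernel P hP) 0 n (fun _ => x) D := by
    rw [← Kernel.traj_map_frestrictLe_apply, Measure.map_apply (by fun_prop) hD]
    rfl
  have h4 : chainLaw P hP x {X | frestrictLe n X ∈ D ∧ X (n + 1) = b} =
      chainLaw P hP x {X | frestrictLe n X ∈ D} * ENNReal.ofReal (P a b) := by
    rw [h2, h3, Measure.compProd_apply_prod hD (measurableSet_singleton b),
      setLIntegral_congr_fun hD (g := fun _ => ENNReal.ofReal (P a b)), setLIntegral_const, mul_comm]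
    intro y hy
    simp only [stepKernel, Kernel.ofFunOfCountable, Kernel.coe_mk, hDa y hy]
    rw [PMF.toMeasure_apply_singleton _ _ (measurableSet_singleton b)]
    rfl
  rw [measureReal_def, h4, ENNReal.toReal_mul, ENNReal.toReal_ofReal (hP.1 a b), ← measureReal_def]

lemma chainLaw_zero (P : Matrix E E ℝ) (hP : P ∈ Matrix.rowStochastic ℝ E) (x : E) :
    (chainLaw P hP x).real {X | X 0 = x} = 1 := by
  have hms : MeasurableSet {y : Finset.Iic 0 → E | y ⟨0, Finset.mem_Iic.2 le_rfl⟩ = x} :=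
    measurableSet_eval_eq _ x
  have h3 : chainLaw P hP x {X | X 0 = x} =
      Kernel.partialTraj (X := fun _ => E) (stepKernel P hP) 0 0 (fun _ => x)
        {y : Finset.Iic 0 → E | y ⟨0, Finset.mem_Iic.2 le_rfl⟩ = x} := by
    rw [← Kernel.traj_map_frestrictLe_apply, Measure.map_apply (by fun_prop) hms]
    rfl
  rw [measureReal_def, h3, Kernel.partialTraj_self, Kernel.id_apply, Measure.dirac_apply' _ hms]
  simp

/-- The probability that the chain is at `b` at time `n + 1` without visiting `K` at the times
`1, …, n`. -/
noncomputable def tabooProb (P : Matrix E E ℝ) (hP : P ∈ Matrix.rowStochastic ℝ E) (x : E)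
    (K : Set E) (n : ℕ) (b : E) : ℝ :=
  (chainLaw P hP x).real {X | X (n + 1) = b ∧ ∀ s, 1 ≤ s → s ≤ n → X s ∉ K}

variable (P : Matrix E E ℝ) (hP : P ∈ Matrix.rowStochastic ℝ E) (x : E) (K : Finset E)

lemma tabooProb_nonneg (n : ℕ) (b : E) : 0 ≤ tabooProb P hP x K n b := measureReal_nonneg

lemma tabooProb_zero (b : E) : tabooProb P hP x K 0 b = P x b := by
  have hms : MeasurableSet {y : Finset.Iic 0 → E | y ⟨0, Finset.mem_Iic.2 le_rfl⟩ = x} :=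
    measurableSet_eval_eq _ x
  have h := chainLaw_inter_next P hP x 0 x b hms fun y hy => hy
  have h0 := chainLaw_zero P hP x
  have hms0 : MeasurableSet {X : ℕ → E | X 0 = x} :=
    measurableSet_eval_eq 0 x
  have hae : ∀ᵐ X ∂(chainLaw P hP x), X 0 = x := by
    rw [measureReal_def, ENNReal.toReal_eq_one_iff] at h0
    exact (prob_compl_eq_zero_iff hms0).2 h0
  have e1 : (chainLaw P hP x).real {X | frestrictLe (π := fun _ => E) 0 X ∈
      {y : Finset.Iic 0 → E | y ⟨0, Finset.mem_Iic.2 le_rfl⟩ = x}} = 1 := h0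
  rw [e1, one_mul] at h
  rw [← h, tabooProb]
  refine measureReal_congr ?_
  filter_upwards [hae] with X hX
  refine propext ⟨fun hh => ⟨hX, hh.1⟩, fun hh => ⟨hh.2, fun s h1 h2 => by omega⟩⟩

lemma tabooProb_succ (n : ℕ) (b : E) :
    tabooProb P hP x K (n + 1) b = ∑ a with a ∉ K, tabooProb P hP x K n a * P a b := by
  have hset : {X : ℕ → E | X (n + 1 + 1) = b ∧ ∀ s, 1 ≤ s → s ≤ n + 1 → X s ∉ K} =
      ⋃ a ∈ Finset.univ.filter (· ∉ K), {X : ℕ → E |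
        (X (n + 1) = a ∧ ∀ s, 1 ≤ s → s ≤ n → X s ∉ K) ∧ X (n + 1 + 1) = b} := by
    ext X
    simp only [Set.mem_ofPred_eq, Set.mem_iUnion, Finset.mem_filter, Finset.mem_univ, true_and,
      exists_prop]
    constructor
    · rintro ⟨h1, h2⟩
      exact ⟨X (n + 1), h2 _ (by omega) le_rfl, ⟨rfl, fun s hs hs' => h2 s hs (by omega)⟩, h1⟩
    · rintro ⟨a, ha, ⟨rfl, h2⟩, h1⟩
      refine ⟨h1, fun s hs hs' => ?_⟩
      rcases hs'.lt_or_eq with h | rfl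
      · exact h2 s hs (by omega)
      · exact ha
  unfold tabooProb
  simp only [Finset.mem_coe]
  rw [hset, measureReal_biUnion_finset]
  · refine Finset.sum_congr rfl fun a _ => ?_
    -- The taboo event depends only on the path up to time `n + 1`; as a set of finite paths it is
    -- accessible to the Markov property.
    let D : Set (Finset.Iic (n + 1) → E) := {y | y ⟨n + 1, Finset.mem_Iic.2 le_rfl⟩ = a ∧
      ∀ s : Finset.Iic (n + 1), 1 ≤ (s : ℕ) → (s : ℕ) ≤ n → y s ∉ K}
    have hD : MeasurableSet D := by
      refine (measurableSet_eval_eq (⟨n + 1, Finset.mem_Iic.2 le_rfl⟩ : Finset.Iic (n + 1)) a).inter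
        (s₂ := {y | ∀ s : Finset.Iic (n + 1), 1 ≤ (s : ℕ) → (s : ℕ) ≤ n → y s ∉ K}) ?_
      simp only [Set.ofPred_forall]
      refine MeasurableSet.iInter fun s => MeasurableSet.iInter fun _ =>
        MeasurableSet.iInter fun _ => ?_
      exact measurableSet_eval_notMem s K
    have hiff : ∀ X : ℕ → E, frestrictLe (π := fun _ => E) (n + 1) X ∈ D ↔
        X (n + 1) = a ∧ ∀ s, 1 ≤ s → s ≤ n → X s ∉ K := fun X =>
      ⟨fun h => ⟨h.1, fun s h1 h2 => h.2 ⟨s, Finset.mem_Iic.2 (by omega)⟩ h1 h2⟩,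
        fun h => ⟨h.1, fun s h1 h2 => h.2 s h1 h2⟩⟩
    have h := chainLaw_inter_next P hP x (n + 1) a b hD fun y hy => hy.1
    simpa only [hiff] using h
  · intro a _ a' _ haa'
    refine Set.disjoint_left.2 fun X hX hX' => haa' ?_
    exact hX.1.1.symm.trans hX'.1.1
  · intro a _
    exact (measurableSet_taboo K n a).inter (measurableSet_eval_eq (n + 1 + 1) b)

/-- The chain hits `j ∈ K` not later than the rest of `K` with probability `∑ n, tabooProb n j`. -/
lemma hasSum_tabooProb (j : E) (hj : j ∈ K) :
    HasSum (fun n => tabooProb P hP x K n j)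
      ((chainLaw P hP x).real {X | ∃ n, X (n + 1) = j ∧ ∀ s, 1 ≤ s → s ≤ n → X s ∉ K}) := by
  have hm := fun n => measurableSet_taboo K n j
  have hdisj : Pairwise (Function.onFun Disjoint fun n =>
      {X : ℕ → E | X (n + 1) = j ∧ ∀ s, 1 ≤ s → s ≤ n → X s ∉ K}) := by
    -- Since `j ∈ K`, being at `j` at time `n + 1` violates the taboo for every later entrance; this
    -- makes the events disjoint.
    have key : ∀ n m, n < m → ∀ X : ℕ → E, (X (n + 1) = j ∧ ∀ s, 1 ≤ s → s ≤ n → X s ∉ K) →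
        ¬(X (m + 1) = j ∧ ∀ s, 1 ≤ s → s ≤ m → X s ∉ K) := by
      intro n m hnm X h1 h2
      exact h2.2 (n + 1) (by omega) (by omega) (h1.1 ▸ hj)
    intro n m hnm
    refine Set.disjoint_left.2 fun X hX hX' => ?_
    rcases lt_or_gt_of_ne hnm with h | h
    · exact key n m h X hX hX'
    · exact key m n h X hX' hX
  have h := measure_iUnion hdisj hm (μ := chainLaw P hP x)
  have hne := measure_ne_top (chainLaw P hP x)
    (⋃ n, {X : ℕ → E | X (n + 1) = j ∧ ∀ s, 1 ≤ s → s ≤ n → X s ∉ K})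
  rw [h] at hne
  rw [Set.ofPred_exists, measureReal_def, h, ENNReal.tsum_toReal_eq fun _ => measure_ne_top _ _]
  exact ENNReal.hasSum_toReal hne

end Chain

/-- `j` is hit before `i` and `o` iff the first entrance into `{i, j, o}` is at `j`. -/
lemma returnTime_lt_min_iff {E : Type*} (i j o : E) (hij : j ≠ i) (hjo : j ≠ o) (X : ℕ → E) :
    returnTime j X < min (returnTime i X) (returnTime o X) ↔
      ∃ n, X (n + 1) = j ∧ ∀ s, 1 ≤ s → s ≤ n → X s ≠ i ∧ X s ≠ j ∧ X s ≠ o := by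
  constructor
  · intro h
    have hne : returnTime j X ≠ ⊤ := (h.trans_le le_top).ne
    obtain ⟨hi, ho⟩ := lt_min_iff.1 h
    obtain ⟨n, hn⟩ := WithTop.ne_top_iff_exists.1 hne
    obtain ⟨m, hm, hmj⟩ := MeasureTheory.hittingAfter_le_iff.1 hn.symm.le
    have hnot : ∀ s, 1 ≤ s → s < n → X s ≠ j := fun s h1 h2 =>
      MeasureTheory.notMem_of_lt_hittingAfter (u := fun s (Y : ℕ → E) => Y s) (s := {j}) (ω := X)
        (n := 1) (lt_of_lt_of_eq (WithTop.coe_lt_coe.2 h2) hn) h1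
    have hmn : m = n := by
      by_contra hne
      exact hnot m hm.1 (lt_of_le_of_ne hm.2 hne) hmj
    have key : ∀ k, returnTime j X < returnTime k X → ∀ s, 1 ≤ s → s ≤ n → X s ≠ k :=
      fun k hk s h1 h2 =>
      MeasureTheory.notMem_of_lt_hittingAfter (u := fun s (Y : ℕ → E) => Y s) (s := {k}) (ω := X)
        (n := 1) (lt_of_le_of_lt (WithTop.coe_le_coe.2 h2) (hn ▸ hk)) h1
    -- Return times start at time `1`, so the hitting time `n` is a successor.
    obtain ⟨p, rfl⟩ : ∃ p, n = p + 1 := ⟨n - 1, by have := hm.1; omega⟩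
    exact ⟨p, hmn ▸ hmj, fun s h1 h2 => ⟨key i hi s h1 (by omega), hnot s h1 (by omega),
      key o ho s h1 (by omega)⟩⟩
  · rintro ⟨n, hn, hs⟩
    have hle : returnTime j X ≤ ((n + 1 : ℕ) : WithTop ℕ) :=
      MeasureTheory.hittingAfter_le_iff.2 ⟨n + 1, ⟨by omega, le_rfl⟩, hn⟩
    have key : ∀ k, j ≠ k → (∀ s, 1 ≤ s → s ≤ n → X s ≠ k) →
        returnTime j X < returnTime k X := by
      intro k hjk hk
      refine hle.trans_lt (not_le.1 fun h => ?_)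
      obtain ⟨s, hs1, hs2⟩ := MeasureTheory.hittingAfter_le_iff.1 h
      have hs' : s ≤ n + 1 := hs1.2
      rcases hs'.lt_or_eq with h | rfl
      · exact hk s hs1.1 (by omega) hs2
      · exact hjk (hn.symm.trans hs2)
    exact lt_min (key i hij fun s h1 h2 => (hs s h1 h2).1)
      (key o hjo fun s h1 h2 => (hs s h1 h2).2.2)

/-! ### The Dirichlet problem for substochastic matrices -/

section Dirichlet

variable {Ω : Type*}

/-- A nonempty set of states which the chain cannot leave, except by being killed, contains every
state. -/
def ClosedSetsTrivial (S : Matrix Ω Ω ℝ) : Prop :=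
  ∀ C : Set Ω, C.Nonempty → (∀ a ∈ C, ∀ b, 0 < S a b → b ∈ C) → ∀ b, b ∈ C

lemma ClosedSetsTrivial.mono {S F : Matrix Ω Ω ℝ} (hS : ClosedSetsTrivial S)
    (h : ∀ a b, S a b ≤ F a b) : ClosedSetsTrivial F :=
  fun C hC hcl => hS C hC fun a ha b hab => hcl a ha b (hab.trans_le (h a b))

variable [Fintype Ω]

lemma closedSetsTrivial_of_isIrreducible [DecidableEq Ω] {S : Matrix Ω Ω ℝ}
    (hirr : S.IsIrreducible) : ClosedSetsTrivial S := by
  rintro C ⟨a, ha⟩ hcl b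
  obtain ⟨k, -, hk⟩ := (Matrix.isIrreducible_iff_exists_pow_pos hirr.nonneg).1 hirr a b
  have key : ∀ n : ℕ, ∀ c, 0 < (S ^ n) a c → c ∈ C := by
    intro n
    induction n with
    | zero =>
      intro c hc
      by_cases h : a = c
      · exact h ▸ ha
      · simp [h] at hc
    | succ n ih =>
      intro c hc
      rw [pow_succ, Matrix.mul_apply] at hc
      obtain ⟨d, -, hd⟩ := Finset.exists_lt_of_sum_lt (f := fun _ => (0 : ℝ)) (by simpa using hc)
      have h1 := Matrix.pow_apply_nonneg hirr.nonneg n a d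
      have h2 := hirr.nonneg d c
      exact hcl d (ih d (pos_of_mul_pos_left hd h2)) c (pos_of_mul_pos_right hd h1)
  exact key k b hk

variable {S : Matrix Ω Ω ℝ}

/-- The minimum principle for superharmonic functions. -/
lemma nonneg_of_superharmonic (hS : IsSubstochastic S) (hcl : ClosedSetsTrivial S) {B : Finset Ω}
    (hB : B.Nonempty) {w : Ω → ℝ} (h0 : ∀ a ∈ B, 0 ≤ w a)
    (h : ∀ a ∉ B, ∑ b, S a b * w b ≤ w a) (a : Ω) : 0 ≤ w a := by
  by_contra hneg
  push Not at hneg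
  have : Nonempty Ω := ⟨a⟩
  obtain ⟨a₀, hmin⟩ := Finite.exists_min w
  have ha₀ : w a₀ < 0 := (hmin a).trans_lt hneg
  -- At a point outside `B`, a negative global minimum forces all successors to share the minimal
  -- value, because row sums are at most one. The set of minimisers is therefore closed, hence
  -- everything, and meets `B`.
  have hall := hcl {c | w c = w a₀} ⟨a₀, rfl⟩ (by
    intro c hc b hb
    have hc' : w c = w a₀ := hc
    have hcB : c ∉ B := fun hcB => by
      have := h0 c hcB
      linarith
    have hterm : ∀ d ∈ Finset.univ, 0 ≤ S c d * (w d - w a₀) := fun d _ =>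
      mul_nonneg (hS.1 c d) (sub_nonneg.2 (hmin d))
    have hsum : ∑ d, S c d * (w d - w a₀) = ∑ d, S c d * w d - (∑ d, S c d) * w a₀ := by
      simp only [mul_sub, Finset.sum_sub_distrib, Finset.sum_mul]
    have hle : ∑ d, S c d * (w d - w a₀) ≤ 0 := by
      rw [hsum]
      nlinarith [h c hcB, hS.2 c]
    have hz := (Finset.sum_eq_zero_iff_of_nonneg hterm).1
      (le_antisymm hle (Finset.sum_nonneg hterm)) b (Finset.mem_univ b)
    rcases mul_eq_zero.1 hz with h | h
    · exact absurd h hb.ne'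
    · exact sub_eq_zero.1 h)
  obtain ⟨b, hb⟩ := hB
  have h1 : w b = w a₀ := hall b
  have h2 := h0 b hb
  linarith

/-- The minimum principle applied to `u` and `-u` makes the homogeneous problem trivial; in finite
dimension, injectivity gives solvability for every `f`. -/
lemma exists_dirichlet [DecidableEq Ω] (hS : IsSubstochastic S) (hcl : ClosedSetsTrivial S)
    {B : Finset Ω} (hB : B.Nonempty) (f : Ω → ℝ) :
    ∃ u : Ω → ℝ, (∀ a ∈ B, u a = f a) ∧ ∀ a ∉ B, u a = f a + ∑ b, S a b * u b := by
  let T : (Ω → ℝ) →ₗ[ℝ] (Ω → ℝ) :=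
    { toFun := fun u a => if a ∈ B then u a else u a - ∑ b, S a b * u b
      map_add' := fun u v => by
        funext a
        by_cases h : a ∈ B <;> simp [h, mul_add, Finset.sum_add_distrib]
        ring
      map_smul' := fun r u => by
        funext a
        by_cases h : a ∈ B <;> simp [h, mul_sub, Finset.mul_sum, mul_left_comm] }
  have hT : ∀ u a, T u a = if a ∈ B then u a else u a - ∑ b, S a b * u b := fun _ _ => rfl
  have hnonneg : ∀ u, T u = 0 → ∀ a, 0 ≤ u a := by
    intro u hu
    refine nonneg_of_superharmonic hS hcl hB (fun a ha => ?_) (fun a ha => ?_)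
    · have := congrFun hu a
      simp only [hT, ha, if_true, Pi.zero_apply] at this
      exact this.ge
    · have := congrFun hu a
      simp only [hT, ha, if_false, Pi.zero_apply] at this
      linarith
  have hinj : Function.Injective T := by
    rw [injective_iff_map_eq_zero]
    intro u hu
    funext a
    have h1 := hnonneg u hu a
    have h2 := hnonneg (-u) (by rw [map_neg, hu, neg_zero]) a
    simp only [Pi.neg_apply, Pi.zero_apply] at h2 ⊢
    linarith
  obtain ⟨u, hu⟩ := (LinearMap.injective_iff_surjective.1 hinj) f
  refine ⟨u, fun a ha => ?_, fun a ha => ?_⟩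
  · rw [← hu, hT, if_pos ha]
  · have := congrFun hu a
    rw [hT, if_neg ha] at this
    linarith

/-- `h a` is the probability that the chain started at `a` is in `j` before it is in `i` and before
it is killed. -/
structure IsHittingProb (S : Matrix Ω Ω ℝ) (i j : Ω) (h : Ω → ℝ) : Prop where
  left : h i = 0
  right : h j = 1
  harmonic : ∀ a, a ≠ i → a ≠ j → h a = ∑ b, S a b * h b
  nonneg : ∀ a, 0 ≤ h a
  le_one : ∀ a, h a ≤ 1

lemma exists_isHittingProb [DecidableEq Ω] (hS : IsSubstochastic S) (hcl : ClosedSetsTrivial S)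
    {i j : Ω} (hij : i ≠ j) : ∃ h, IsHittingProb S i j h := by
  obtain ⟨h, h1, h2⟩ := exists_dirichlet hS hcl (B := {i, j}) ⟨i, by simp⟩
    (fun a => if a = j then 1 else 0)
  have hi : h i = 0 := by rw [h1 i (by simp), if_neg hij]
  have hj : h j = 1 := by rw [h1 j (by simp), if_pos rfl]
  have hh : ∀ a, a ∉ ({i, j} : Finset Ω) → h a = ∑ b, S a b * h b := by
    intro a ha
    have := h2 a ha
    rw [if_neg (fun h => ha (by simp [h])), zero_add] at this
    exact this
  refine ⟨h, hi, hj, fun a hai haj => hh a (by simp [hai, haj]), ?_, fun a => ?_⟩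
  · refine nonneg_of_superharmonic hS hcl (B := {i, j}) ⟨i, by simp⟩ (fun a ha => ?_)
      (fun a ha => (hh a ha).ge)
    rcases Finset.mem_insert.1 ha with rfl | ha
    · exact hi.ge
    · rw [Finset.mem_singleton.1 ha, hj]
      exact zero_le_one
  -- Row sums at most one make `1 - h` superharmonic off `{i, j}`.
  · refine sub_nonneg.1 (nonneg_of_superharmonic hS hcl (B := {i, j}) ⟨i, by simp⟩
      (w := fun a => 1 - h a) (fun a ha => ?_) (fun a ha => ?_) a)
    · rcases Finset.mem_insert.1 ha with rfl | ha
      · simp [hi]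
      · simp [Finset.mem_singleton.1 ha, hj]
    · simp only [mul_sub, mul_one, Finset.sum_sub_distrib, ← hh a ha]
      linarith [hS.2 a]

/-- If the sum vanished, the zero set of `h` would contain `i` and be closed under positive
transitions, so it would contain `j`, where `h = 1`. -/
lemma IsHittingProb.sum_pos (hS : IsSubstochastic S) (hcl : ClosedSetsTrivial S) {i j : Ω}
    {h : Ω → ℝ} (hh : IsHittingProb S i j h) : 0 < ∑ b, S i b * h b := by
  have hterm : ∀ a, ∀ b ∈ Finset.univ, 0 ≤ S a b * h b := fun a b _ =>
    mul_nonneg (hS.1 a b) (hh.nonneg b)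
  refine lt_of_le_of_ne (Finset.sum_nonneg (hterm i)) fun h0 => ?_
  have hall := hcl {a | h a = 0} ⟨i, hh.left⟩ (by
    intro a ha b hb
    have ha' : h a = 0 := ha
    have hs : ∑ b, S a b * h b = 0 := by
      by_cases hai : a = i
      · rw [hai, ← h0]
      · rw [← hh.harmonic a hai (fun h => by rw [h, hh.right] at ha'; norm_num at ha'), ha']
    have := (Finset.sum_eq_zero_iff_of_nonneg (hterm a)).1 hs b (Finset.mem_univ b)
    rcases mul_eq_zero.1 this with h | h
    · exact absurd h hb.ne'
    · exact h)
  have h1 : h j = 0 := hall j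
  rw [hh.right] at h1
  norm_num at h1

/-- Monotonicity of the hitting probabilities in the transition matrix. -/
lemma IsHittingProb.le_of_le {F : Matrix Ω Ω ℝ} (hF : IsSubstochastic F)
    (hcl : ClosedSetsTrivial F) (hle : ∀ a b, S a b ≤ F a b) {i j : Ω} {h g : Ω → ℝ}
    (hh : IsHittingProb S i j h) (hg : IsHittingProb F i j g) (a : Ω) : h a ≤ g a := by
  classical
  refine sub_nonneg.1 (nonneg_of_superharmonic hF hcl (B := {i, j}) ⟨i, by simp⟩
      (w := fun a => g a - h a) (fun a ha => ?_) (fun a ha => ?_) a)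
  · rcases Finset.mem_insert.1 ha with rfl | ha
    · simp [hh.left, hg.left]
    · simp [Finset.mem_singleton.1 ha, hh.right, hg.right]
  · simp only [Finset.mem_insert, Finset.mem_singleton, not_or] at ha
    have : ∑ b, S a b * h b ≤ ∑ b, F a b * h b :=
      Finset.sum_le_sum fun b _ => mul_le_mul_of_nonneg_right (hle a b) (hh.nonneg b)
    simp only [mul_sub, Finset.sum_sub_distrib]
    rw [hg.harmonic a ha.1 ha.2, hh.harmonic a ha.1 ha.2]
    linarith

/-- Replacing `g` by the smaller `h` and keeping only the term `b = j` of `∑ b, (F i b - S i b) * h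
b` suffices, because `h j = 1`. This puts `F i j - S i j` into the denominators of the logarithmic
bound. -/
lemma IsHittingProb.sum_le_sum {F : Matrix Ω Ω ℝ} (hF : IsSubstochastic F)
    (hcl : ClosedSetsTrivial F) (hle : ∀ a b, S a b ≤ F a b) {i j : Ω} {h g : Ω → ℝ}
    (hh : IsHittingProb S i j h) (hg : IsHittingProb F i j g) :
    F i j - S i j + ∑ b, S i b * h b ≤ ∑ b, F i b * g b := by
  have h1 : ∑ b, F i b * h b ≤ ∑ b, F i b * g b := Finset.sum_le_sum fun b _ =>
    mul_le_mul_of_nonneg_left (hh.le_of_le hF hcl hle hg b) (hF.1 i b)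
  have h2 : (F i j - S i j) * h j ≤ ∑ b, (F i b - S i b) * h b :=
    Finset.single_le_sum (f := fun b => (F i b - S i b) * h b)
      (fun b _ => mul_nonneg (sub_nonneg.2 (hle i b)) (hh.nonneg b)) (Finset.mem_univ j)
  rw [hh.right, mul_one] at h2
  simp only [sub_mul, Finset.sum_sub_distrib] at h2
  linarith

end Dirichlet

/-! ### Identification of `Q` through the Dirichlet problem -/

section Telescope

variable {E : Type*} [Fintype E] [DecidableEq E] [MeasurableSpace E] [MeasurableSingletonClass E]

/-- Mass in `K` stops and the rest takes one more step, where `u` is expanded by its equation.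
Summed over `n`, this telescopes: a discrete Dynkin formula for the stopped chain. -/
lemma sum_tabooProb_mul (P : Matrix E E ℝ) (hP : P ∈ Matrix.rowStochastic ℝ E) (x : E)
    (K : Finset E) {u g : E → ℝ} (hu : ∀ a ∉ K, u a = g a + ∑ b, P a b * u b) (n : ℕ) :
    ∑ b, tabooProb P hP x K n b * u b =
      ∑ b ∈ K, tabooProb P hP x K n b * u b + ∑ b with b ∉ K, tabooProb P hP x K n b * g b +
        ∑ c, tabooProb P hP x K (n + 1) c * u c := by
  have h1 : ∑ c, tabooProb P hP x K (n + 1) c * u c =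
      ∑ b with b ∉ K, tabooProb P hP x K n b * ∑ c, P b c * u c := by
    simp only [tabooProb_succ, Finset.sum_mul, Finset.mul_sum]
    rw [Finset.sum_comm]
    simp only [mul_assoc]
  rw [h1, add_assoc, ← Finset.sum_add_distrib]
  rw [← Finset.sum_filter_add_sum_filter_not Finset.univ (· ∈ K)]
  congr 1
  · refine Finset.sum_congr (by ext; simp) fun _ _ => rfl
  · refine Finset.sum_congr rfl fun b hb => ?_
    rw [hu b (Finset.mem_filter.1 hb).2, mul_add]

end Telescope

/-- The coefficient `Q_ij(S)` in terms of hitting probabilities. -/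
lemma Q_eq_sum {Ω : Type*} [Fintype Ω] [DecidableEq Ω] {S : Matrix Ω Ω ℝ}
    (hS : IsSubstochastic S) (hcl : ClosedSetsTrivial S) {i j : Ω} (hij : i ≠ j) {h : Ω → ℝ}
    (hh : IsHittingProb S i j h) : Q S hS i j = ∑ b, S i b * h b := by
  let K : Finset (Option Ω) := {some i, some j, none}
  let : MeasurableSpace (Option Ω) := ⊤
  have hji : some j ≠ some i := fun h => hij (Option.some.inj h).symm
  -- `v` plays the role of the expected time until `i`, `j` or killing; its finiteness will force
  -- the surviving mass `R n` to be summable.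
  obtain ⟨v, hv1, hv2⟩ := exists_dirichlet hS hcl (B := {i, j}) ⟨i, by simp⟩
    (fun a => if a = i ∨ a = j then 0 else 1)
  have hvi : v i = 0 := by rw [hv1 i (by simp), if_pos (Or.inl rfl)]
  have hvj : v j = 0 := by rw [hv1 j (by simp), if_pos (Or.inr rfl)]
  have hv2' : ∀ a ∉ ({i, j} : Finset Ω), v a = 1 + ∑ b, S a b * v b := by
    intro a ha
    have := hv2 a ha
    rwa [if_neg (by simpa using ha)] at this
  have hv0 : ∀ a, 0 ≤ v a := by
    refine nonneg_of_superharmonic hS hcl (B := {i, j}) ⟨i, by simp⟩ (fun a ha => ?_)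
      (fun a ha => by linarith [hv2' a ha])
    rcases Finset.mem_insert.1 ha with rfl | ha
    · exact hvi.ge
    · exact (Finset.mem_singleton.1 ha ▸ hvj).ge
  let w := tabooProb (augmented S) (augmented_mem hS) (some i) K
  have hw0 : ∀ n b, 0 ≤ w n b := tabooProb_nonneg _ _ _ _
  let V : Option Ω → ℝ := fun a => a.elim 0 v
  let H : Option Ω → ℝ := fun a => a.elim 0 h
  let R : ℕ → ℝ := fun n => ∑ b with b ∉ K, w n b
  have hR0 : ∀ n, 0 ≤ R n := fun n => Finset.sum_nonneg fun b _ => hw0 n b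
  have hV : ∀ n, ∑ b, w n b * V b = R n + ∑ c, w (n + 1) c * V c := by
    intro n
    have := sum_tabooProb_mul (augmented S) (augmented_mem hS) (some i) K (u := V)
      (g := fun _ => 1) (by
        rintro (_ | a) ha
        · simp [K] at ha
        · simp only [K, Finset.mem_insert, Option.some.injEq, Finset.mem_singleton, not_or] at ha
          simpa [Fintype.sum_option, V, augmented] using hv2' a (by simp [ha.1, ha.2.1])) n
    simpa [K, V, hvi, hvj, hji, hij, R, w] using this
  have hH : ∀ n, ∑ b, w n b * H b = w n (some j) + ∑ c, w (n + 1) c * H c := by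
    intro n
    have := sum_tabooProb_mul (augmented S) (augmented_mem hS) (some i) K (u := H)
      (g := fun _ => 0) (by
        rintro (_ | a) ha
        · simp [K] at ha
        · simp only [K, Finset.mem_insert, Option.some.injEq, Finset.mem_singleton, not_or] at ha
          simpa [Fintype.sum_option, H, augmented] using hh.harmonic a ha.1 ha.2.1) n
    simpa [K, H, hh.left, hh.right, hji, hij, w] using this
  have hVsum : ∀ n, ∑ m ∈ Finset.range n, R m + ∑ b, w n b * V b = ∑ b, w 0 b * V b := by
    intro n
    induction n with
    | zero => simp
    | succ n ih => rw [Finset.sum_range_succ, ← ih, hV n]; ring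
  have hHsum : ∀ n, ∑ m ∈ Finset.range n, w m (some j) + ∑ b, w n b * H b =
      ∑ b, w 0 b * H b := by
    intro n
    induction n with
    | zero => simp
    | succ n ih => rw [Finset.sum_range_succ, ← ih, hH n]; ring
  have hRsum : Summable R := by
    refine summable_of_sum_range_le hR0 (c := ∑ b, w 0 b * V b) fun n => ?_
    have : 0 ≤ ∑ b, w n b * V b := Finset.sum_nonneg fun b _ => mul_nonneg (hw0 n b) (by
      rcases b with _ | b
      · exact le_rfl
      · exact hv0 b)
    linarith [hVsum n]
  have hQ : HasSum (fun n => w n (some j)) (Q S hS i j) := by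
    have := hasSum_tabooProb (augmented S) (augmented_mem hS) (some i) K (some j) (by simp [K])
    have hset : {X : ℕ → Option Ω | ∃ n, X (n + 1) = some j ∧ ∀ s, 1 ≤ s → s ≤ n → X s ∉ K} =
        {X | returnTime (some j) X < min (returnTime (some i) X) (returnTime none X)} := by
      ext X
      simp only [Set.mem_ofPred_eq]
      rw [returnTime_lt_min_iff _ _ _ hji (by simp)]
      simp [K]
    rw [hset] at this
    exact this
  -- On `K` the function `H` is nonzero only at `j`, and elsewhere it is at most one, so the
  -- remainder is at most `w n (some j) + R n`. Both are terms of convergent series.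
  have hrest : Filter.Tendsto (fun n => ∑ b, w n b * H b) Filter.atTop (nhds 0) := by
    have hlim := hQ.summable.tendsto_atTop_zero.add hRsum.tendsto_atTop_zero
    rw [add_zero] at hlim
    refine squeeze_zero (fun n => Finset.sum_nonneg fun b _ => mul_nonneg (hw0 n b) ?_)
      (fun n => ?_) hlim
    · rcases b with _ | b
      · exact le_rfl
      · exact hh.nonneg b
    · rw [← Finset.sum_filter_add_sum_filter_not Finset.univ (· ∈ K)]
      refine add_le_add (le_of_eq ?_) (Finset.sum_le_sum fun b _ => ?_)
      · rw [Finset.filter_mem_eq_inter, Finset.univ_inter]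
        simp [K, H, hh.left, hh.right, hij]
      · refine mul_le_of_le_one_right (hw0 n b) ?_
        rcases b with _ | b
        · exact zero_le_one
        · exact hh.le_one b
  have hlim := hQ.tendsto_sum_nat.add hrest
  simp only [hHsum, add_zero] at hlim
  rw [tendsto_nhds_unique hlim tendsto_const_nhds]
  simp [w, tabooProb_zero, Fintype.sum_option, H, augmented]

/-! ### The invariant distribution of a stochastic matrix above `S` -/

section Reversal

variable {Ω : Type*} {F : Matrix Ω Ω ℝ}

/-- The transition matrix of the time reversal of a stationary chain. -/
noncomputable def reversal (F : Matrix Ω Ω ℝ) (p : Ω → ℝ) : Matrix Ω Ω ℝ :=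
  Matrix.of fun a b => p b * F b a / p a

/-- Reversal turns arrows around, so the complement of a closed set of the reversed chain is closed
for `F`. -/
lemma closedSetsTrivial_reversal (hcl : ClosedSetsTrivial F) {p : Ω → ℝ}
    (hp : ∀ a, 0 < p a) : ClosedSetsTrivial (reversal F p) := by
  rintro C ⟨c, hc⟩ hC b
  by_contra hb
  refine hcl Cᶜ ⟨b, hb⟩ (fun a ha d hd hdC => ha ?_) c hc
  exact hC d hdC a (div_pos (mul_pos (hp a) hd) (hp d))

lemma isSubstochastic_reversal [Fintype Ω] (hF : ∀ a b, 0 ≤ F a b) {p : Ω → ℝ}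
    (hp : ∀ a, 0 < p a) (hpF : Matrix.vecMul p F = p) : IsSubstochastic (reversal F p) := by
  refine ⟨fun a b => div_nonneg (mul_nonneg (hp b).le (hF b a)) (hp a).le, fun a => ?_⟩
  have := congrFun hpF a
  simp only [Matrix.vecMul, dotProduct] at this
  simp only [reversal, Matrix.of_apply, ← Finset.sum_div, this]
  exact (div_self (hp a).ne').le

end Reversal

/-! ### Green's functions and exact perturbation of the invariant distribution -/

section InvariantDist

variable {Ω : Type*} [Fintype Ω] [DecidableEq Ω] {S F G : Matrix Ω Ω ℝ}

lemma isIrreducible_of_le (hirr : S.IsIrreducible) (h : ∀ a b, S a b ≤ F a b) :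
    F.IsIrreducible := by
  have hF0 : ∀ a b, 0 ≤ F a b := fun a b => (hirr.nonneg a b).trans (h a b)
  have hpow : ∀ n : ℕ, ∀ a b, (S ^ n) a b ≤ (F ^ n) a b := by
    intro n
    induction n with
    | zero => simp
    | succ n ih =>
      intro a b
      rw [pow_succ, pow_succ, Matrix.mul_apply, Matrix.mul_apply]
      exact Finset.sum_le_sum fun c _ => mul_le_mul (ih a c) (h c b) (hirr.nonneg c b)
        (Matrix.pow_apply_nonneg hF0 n a c)
  rw [Matrix.isIrreducible_iff_exists_pow_pos hF0]
  intro a b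
  obtain ⟨k, hk, hk'⟩ := (Matrix.isIrreducible_iff_exists_pow_pos hirr.nonneg).1 hirr a b
  exact ⟨k, hk, hk'.trans_le (hpow k a b)⟩

lemma isSubstochastic_of_mem (hF : F ∈ Matrix.rowStochastic ℝ Ω) : IsSubstochastic F := by
  rw [Matrix.mem_rowStochastic_iff_sum] at hF
  exact ⟨hF.1, fun a => (hF.2 a).le⟩

lemma invDist_spec [Nonempty Ω] (hF : F ∈ Matrix.rowStochastic ℝ Ω) (hirr : F.IsIrreducible) :
    IsInvariantDist F (invDist F) := by
  have h := existsUnique_isInvariantDist hF hirr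
  rw [invDist, dif_pos h]
  exact h.choose_spec.1

lemma invDist_eq [Nonempty Ω] (hF : F ∈ Matrix.rowStochastic ℝ Ω) (hirr : F.IsIrreducible)
    {p : Ω → ℝ} (hp : IsInvariantDist F p) : p = invDist F :=
  (existsUnique_isInvariantDist hF hirr).unique hp (invDist_spec hF hirr)

/-- The normalised absolute value of the invariant distribution is also invariant, so uniqueness
gives nonnegativity; irreducibility then spreads positivity to every state. -/
lemma invDist_pos [Nonempty Ω] (hF : F ∈ Matrix.rowStochastic ℝ Ω) (hirr : F.IsIrreducible)
    (m : Ω) : 0 < invDist F m := by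
  obtain ⟨h1, h2⟩ := invDist_spec hF hirr
  have habs := vecMul_abs hF h1
  have hle : 1 ≤ ∑ a, |invDist F a| := h2 ▸ Finset.sum_le_sum fun a _ => le_abs_self _
  have hpos : 0 < ∑ a, |invDist F a| := by linarith
  have hinv : IsInvariantDist F ((∑ a, |invDist F a|)⁻¹ • fun a => |invDist F a|) := by
    refine ⟨by rw [Matrix.smul_vecMul, habs], ?_⟩
    simp only [Pi.smul_apply, smul_eq_mul, ← Finset.mul_sum]
    exact inv_mul_cancel₀ hpos.ne'
  have heq := congrFun (invDist_eq hF hirr hinv)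
  have h0 : ∀ a, 0 ≤ invDist F a := fun a => by
    rw [← heq a]
    exact mul_nonneg (inv_nonneg.2 hpos.le) (abs_nonneg _)
  obtain ⟨a, -, ha⟩ := Finset.exists_lt_of_sum_lt (s := Finset.univ) (f := fun _ : Ω => (0 : ℝ))
    (g := invDist F) (by rw [h2]; simp)
  exact pos_of_vecMul hirr h0 h1 ha m

lemma invDist_le_one [Nonempty Ω] (hF : F ∈ Matrix.rowStochastic ℝ Ω) (hirr : F.IsIrreducible)
    (m : Ω) : invDist F m ≤ 1 := by
  rw [← (invDist_spec hF hirr).2]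
  exact Finset.single_le_sum (fun a _ => (invDist_pos hF hirr a).le) (Finset.mem_univ m)

lemma eq_zero_of_vecMul_eq [Nonempty Ω] (hF : F ∈ Matrix.rowStochastic ℝ Ω)
    (hirr : F.IsIrreducible) {v : Ω → ℝ} (hv : Matrix.vecMul v F = v) (hs : ∑ a, v a = 0) :
    v = 0 := by
  obtain ⟨h1, h2⟩ := invDist_spec hF hirr
  have := invDist_eq hF hirr (p := v + invDist F)
    ⟨by rw [Matrix.add_vecMul, hv, h1], by simp [Finset.sum_add_distrib, hs, h2]⟩
  simpa using this

/-- The Green's function of a stationary chain for a unit source at `k` and a unit sink at `l`. -/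
lemma exists_green [Nonempty Ω] (hF : F ∈ Matrix.rowStochastic ℝ Ω) (hirr : F.IsIrreducible)
    {k l : Ω} (hkl : k ≠ l) {h : Ω → ℝ} (hh : IsHittingProb F k l h) :
    ∃ z : Ω → ℝ, ∑ a, z a = 0 ∧ (∀ m, |z m| ≤ invDist F m) ∧
      z - Matrix.vecMul z F =
        (invDist F k * ∑ b, F k b * h b) • (Pi.single k (1 : ℝ) - Pi.single l (1 : ℝ)) := by
  obtain ⟨h1, h2⟩ := invDist_spec hF hirr
  have hpos := invDist_pos hF hirr
  have hFsum := (Matrix.mem_rowStochastic_iff_sum.1 hF).2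
  set p := invDist F with hp
  obtain ⟨g, hg⟩ := exists_isHittingProb (isSubstochastic_reversal hF.1 hpos h1)
    (closedSetsTrivial_reversal (closedSetsTrivial_of_isIrreducible hirr) hpos) hkl.symm
  -- `x = z - z F` for the uncentred `z = p g`, with `g` the reversed chain's probability of hitting
  -- `k` before `l`. Harmonicity of `g` for the reversal says that `x` lives on `{k, l}`.
  let x : Ω → ℝ := fun b => p b * g b - ∑ a, p a * g a * F a b
  have hx : ∀ b, b ≠ k → b ≠ l → x b = 0 := by
    intro b hbk hbl
    have : p b * g b = ∑ a, p a * g a * F a b := by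
      rw [hg.harmonic b hbl hbk, Finset.mul_sum]
      refine Finset.sum_congr rfl fun a _ => ?_
      simp only [reversal, Matrix.of_apply]
      field_simp [(hpos b).ne']
    simp only [x, this, sub_self]
  have hsum2 : ∀ f : Ω → ℝ, ∑ b, x b * f b = x k * f k + x l * f l := by
    intro f
    rw [← Finset.sum_pair hkl (f := fun b => x b * f b)]
    refine (Finset.sum_subset (Finset.subset_univ _) fun b _ hb => ?_).symm
    simp only [Finset.mem_insert, Finset.mem_singleton, not_or] at hb
    rw [hx b hb.1 hb.2, zero_mul]
  have hpair : ∀ f : Ω → ℝ, ∑ b, x b * f b = ∑ a, p a * g a * (f a - ∑ b, F a b * f b) := by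
    intro f
    simp only [x, sub_mul, mul_sub, Finset.sum_sub_distrib, Finset.sum_mul, Finset.mul_sum]
    rw [Finset.sum_comm (f := fun b a => p a * g a * F a b * f b)]
    simp only [mul_assoc]
  have hx1 : x k + x l = 0 := by
    have e := hsum2 fun _ => 1
    rw [hpair] at e
    simp only [mul_one, hFsum, sub_self, mul_zero, Finset.sum_const_zero] at e
    exact e.symm
  -- Pairing `x` with `h` isolates `x l`, since `h k = 0` and `h l = 1`. On the dual side only `a =
  -- k` survives: `h` is harmonic off `{k, l}` and `g l = 0`.
  have hx2 : x l = -(p k * ∑ b, F k b * h b) := by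
    have e := hsum2 h
    rw [hpair, hh.left, hh.right, mul_zero, zero_add, mul_one] at e
    rw [← e, Finset.sum_eq_single k]
    · rw [hg.right, hh.left]
      ring
    · intro a _ hak
      by_cases hal : a = l
      · rw [hal, hg.left]
        ring
      · rw [← hh.harmonic a hak hal]
        ring
    · simp
  -- Subtracting `c • p` makes the sum zero without changing `z - z F`. As `g` and `c` both lie in
  -- `[0, 1]`, the factor `g m - c` has absolute value at most one.
  set c := ∑ a, p a * g a with hc
  have hc0 : 0 ≤ c := Finset.sum_nonneg fun a _ => mul_nonneg (hpos a).le (hg.nonneg a)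
  have hc1 : c ≤ 1 := h2 ▸ Finset.sum_le_sum fun a _ =>
    mul_le_of_le_one_right (hpos a).le (hg.le_one a)
  refine ⟨(fun a => p a * g a) - c • p, ?_, fun m => ?_, ?_⟩
  · simp only [Pi.sub_apply, Pi.smul_apply, smul_eq_mul, Finset.sum_sub_distrib, ← Finset.mul_sum,
      h2, ← hc]
    ring
  · have : ((fun a => p a * g a) - c • p) m = p m * (g m - c) := by
      simp only [Pi.sub_apply, Pi.smul_apply, smul_eq_mul]
      ring
    rw [this, abs_mul, abs_of_pos (hpos m)]
    refine mul_le_of_le_one_right (hpos m).le (abs_le.2 ⟨?_, ?_⟩)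
    · linarith [hg.nonneg m]
    · linarith [hg.le_one m]
  · rw [Matrix.sub_vecMul, Matrix.smul_vecMul, h1]
    funext b
    have hxb : ((fun a => p a * g a) - c • p - (Matrix.vecMul (fun a => p a * g a) F - c • p)) b =
        x b := by
      simp only [Pi.sub_apply, x, Matrix.vecMul, dotProduct]
      ring
    rw [hxb]
    simp only [Pi.smul_apply, Pi.sub_apply, smul_eq_mul]
    by_cases hbk : b = k
    · subst hbk
      rw [Pi.single_eq_same, Pi.single_eq_of_ne hkl]
      linarith
    · by_cases hbl : b = l
      · subst hbl
        rw [Pi.single_eq_same, Pi.single_eq_of_ne hbk]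
        linarith
      · rw [hx b hbk hbl, Pi.single_eq_of_ne hbk, Pi.single_eq_of_ne hbl]
        ring

lemma Q_pos (hS : IsSubstochastic S) (hirr : S.IsIrreducible) {i j : Ω} (hij : i ≠ j) :
    0 < Q S hS i j := by
  have hcl := closedSetsTrivial_of_isIrreducible hirr
  obtain ⟨h, hh⟩ := exists_isHittingProb hS hcl hij
  rw [Q_eq_sum hS hcl hij hh]
  exact hh.sum_pos hS hcl

/-- An exact perturbation formula for the invariant distribution. -/
lemma exists_perturbation_formula [Nonempty Ω] (hS : IsSubstochastic S) (hirr : S.IsIrreducible)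
    (hF : IsStochasticAbove S F) :
    ∃ Z : Ω → Ω → Ω → ℝ,
      (∀ k l, l ≠ k → ∀ m,
        |invDist F k * Z k l m| ≤ invDist F m * (F k l - S k l + Q S hS k l)⁻¹) ∧
      ∀ G, IsStochasticAbove S G → ∀ m, invDist G m - invDist F m =
        ∑ k, ∑ l with l ≠ k, (G k l - F k l) * (invDist G k * Z k l m) := by
  have hFirr := isIrreducible_of_le hirr hF.2
  have hpos := invDist_pos hF.1 hFirr
  have hcl := closedSetsTrivial_of_isIrreducible hirr
  have key : ∀ k l, ∃ z : Ω → ℝ, l ≠ k → ∑ a, z a = 0 ∧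
      (∀ m, |invDist F k * z m| ≤ invDist F m * (F k l - S k l + Q S hS k l)⁻¹) ∧
      z - Matrix.vecMul z F = Pi.single l (1 : ℝ) - Pi.single k (1 : ℝ) := by
    intro k l
    by_cases hlk : l = k
    · exact ⟨0, fun h => absurd hlk h⟩
    have hkl : k ≠ l := fun h => hlk h.symm
    have hFs := isSubstochastic_of_mem hF.1
    obtain ⟨h, hh⟩ := exists_isHittingProb hS hcl hkl
    obtain ⟨f, hf⟩ := exists_isHittingProb hFs (hcl.mono hF.2) hkl
    obtain ⟨z, hz1, hz2, hz3⟩ := exists_green hF.1 hFirr hkl hf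
    have hle := hh.sum_le_sum hFs (hcl.mono hF.2) hF.2 hf
    rw [← Q_eq_sum hS hcl hkl hh] at hle
    set q := ∑ b, F k b * f b
    have hQ := Q_pos hS hirr hkl
    have hd : 0 < F k l - S k l + Q S hS k l := by linarith [hF.2 k l]
    have hq : 0 < q := hd.trans_le hle
    have hpk := hpos k
    refine ⟨(-(invDist F k * q)⁻¹) • z, fun _ => ⟨?_, fun m => ?_, ?_⟩⟩
    · simp only [Pi.smul_apply, ← Finset.smul_sum, hz1, smul_zero]
    · have e : invDist F k * ((-(invDist F k * q)⁻¹) • z) m = -(z m * q⁻¹) := by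
        simp only [Pi.smul_apply, smul_eq_mul]
        field_simp
      rw [e, abs_neg, abs_mul, abs_of_pos (inv_pos.2 hq)]
      exact mul_le_mul (hz2 m) (inv_anti₀ hd hle) (inv_pos.2 hq).le (hpos m).le
    · rw [Matrix.smul_vecMul, ← smul_sub, hz3, smul_smul, neg_mul,
        inv_mul_cancel₀ (mul_pos hpk hq).ne', neg_one_smul, neg_sub]
  choose Z hZ using key
  refine ⟨Z, fun k l hlk => (hZ k l hlk).2.1, fun G hG m => ?_⟩
  obtain ⟨hp1, hp2⟩ := invDist_spec hF.1 hFirr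
  obtain ⟨hq1, hq2⟩ := invDist_spec hG.1 (isIrreducible_of_le hirr hG.2)
  have hFsum := (Matrix.mem_rowStochastic_iff_sum.1 hF.1).2
  have hGsum := (Matrix.mem_rowStochastic_iff_sum.1 hG.1).2
  set p := invDist F
  set q := invDist G
  let y : Ω → ℝ := ∑ k, ∑ l with l ≠ k, ((G k l - F k l) * q k) • Z k l
  let L : (Ω → ℝ) →ₗ[ℝ] (Ω → ℝ) := LinearMap.id - F.vecMulLinear
  have hL : ∀ v, L v = v - Matrix.vecMul v F := fun _ => rfl
  -- Invariance of `q` under `G` gives `L q = q (G - F)`. The rows of `G - F` sum to zero, so this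
  -- is a combination of the dipoles `e_l - e_k`, which are the images of the `Z k l`.
  have hLy : L y = L q := by
    have e1 : L y = ∑ k, ∑ l, ((G k l - F k l) * q k) •
        (Pi.single l (1 : ℝ) - Pi.single k (1 : ℝ) : Ω → ℝ) := by
      simp only [y, map_sum, map_smul]
      refine Finset.sum_congr rfl fun k _ => ?_
      rw [Finset.sum_filter]
      refine Finset.sum_congr rfl fun l _ => ?_
      split_ifs with hlk
      · rw [hL, (hZ k l hlk).2.2]
      · rw [not_not.1 hlk, sub_self, smul_zero]
    rw [e1, hL]
    funext b
    simp only [Finset.sum_apply, Pi.smul_apply, Pi.sub_apply, smul_eq_mul, mul_sub,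
      Finset.sum_sub_distrib]
    have e2 : ∀ k, ∑ l, (G k l - F k l) * q k * (Pi.single k (1 : ℝ) : Ω → ℝ) b = 0 := by
      intro k
      simp only [← Finset.sum_mul, Finset.sum_sub_distrib, hFsum, hGsum]
      ring
    have e3 : ∀ k, ∑ l, (G k l - F k l) * q k * (Pi.single l (1 : ℝ) : Ω → ℝ) b =
        q k * G k b - q k * F k b := by
      intro k
      rw [Finset.sum_eq_single b (fun l _ hl => by rw [Pi.single_eq_of_ne hl.symm, mul_zero])
        (by simp), Pi.single_eq_same]
      ring
    simp only [e2, e3, Finset.sum_const_zero, sub_zero, Finset.sum_sub_distrib]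
    have := congrFun hq1 b
    simp only [Matrix.vecMul, dotProduct] at this ⊢
    rw [this]
  have hy0 : ∑ a, y a = 0 := by
    simp only [y, Finset.sum_apply]
    rw [Finset.sum_comm]
    refine Finset.sum_eq_zero fun k _ => ?_
    rw [Finset.sum_comm]
    refine Finset.sum_eq_zero fun l hl => ?_
    simp only [Pi.smul_apply, ← Finset.smul_sum, (hZ k l (Finset.mem_filter.1 hl).2).1, smul_zero]
  have hLp : L p = 0 := by rw [hL, hp1, sub_self]
  have hfix : L (q - p - y) = 0 := by rw [map_sub, map_sub, hLy, hLp]; simp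
  have h0 := eq_zero_of_vecMul_eq hF.1 hFirr (v := q - p - y) (by
      rw [hL, sub_eq_zero] at hfix
      exact hfix.symm)
    (by simp [Finset.sum_sub_distrib, hp2, hq2, hy0])
  have hm := congrFun (sub_eq_zero.1 h0) m
  simp only [Pi.sub_apply, y, Finset.sum_apply, Pi.smul_apply, smul_eq_mul, mul_assoc] at hm
  exact hm

end InvariantDist

/-! ### Differentiation along segments and the two error bounds -/

section ErrorBounds

variable {Ω : Type*} [Fintype Ω] [DecidableEq Ω] {S F G : Matrix Ω Ω ℝ}

lemma IsStochasticAbove.segment (hF : IsStochasticAbove S F) (hG : IsStochasticAbove S G) {t : ℝ}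
    (ht : t ∈ Set.Icc (0 : ℝ) 1) : IsStochasticAbove S (F + t • (G - F)) := by
  obtain ⟨hF1, hF2⟩ := hF
  obtain ⟨hG1, hG2⟩ := hG
  rw [Matrix.mem_rowStochastic_iff_sum] at hF1 hG1
  have e : ∀ a b, (F + t • (G - F)) a b = (1 - t) * F a b + t * G a b := fun a b => by
    simp only [Matrix.add_apply, Matrix.smul_apply, Matrix.sub_apply, smul_eq_mul]
    ring
  have h1 : 0 ≤ 1 - t := sub_nonneg.2 ht.2
  refine ⟨Matrix.mem_rowStochastic_iff_sum.2 ⟨fun a b => ?_, fun a => ?_⟩, fun a b => ?_⟩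
  · rw [e]
    exact add_nonneg (mul_nonneg h1 (hF1.1 a b)) (mul_nonneg ht.1 (hG1.1 a b))
  · simp only [e, Finset.sum_add_distrib, ← Finset.mul_sum, hF1.2, hG1.2]
    ring
  · rw [e]
    nlinarith [mul_le_mul_of_nonneg_left (hF2 a b) h1, mul_le_mul_of_nonneg_left (hG2 a b) ht.1]

/-- The derivative of the invariant distribution along a segment of stochastic matrices. -/
lemma exists_hasDerivWithinAt_invDist [Nonempty Ω] (hS : IsSubstochastic S)
    (hirr : S.IsIrreducible) (hF : IsStochasticAbove S F) (hG : IsStochasticAbove S G) {t : ℝ}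
    (ht : t ∈ Set.Icc (0 : ℝ) 1) (m : Ω) :
    ∃ d, HasDerivWithinAt (fun s => invDist (F + s • (G - F)) m) d (Set.Icc 0 1) t ∧
      |d| ≤ invDist (F + t • (G - F)) m *
        ∑ k, ∑ l with l ≠ k, |G k l - F k l| *
          ((F + t • (G - F)) k l - S k l + Q S hS k l)⁻¹ := by
  have hseg := fun {s : ℝ} (hs : s ∈ Set.Icc (0 : ℝ) 1) => hF.segment hG hs
  obtain ⟨Z, hZ, hpert⟩ := exists_perturbation_formula hS hirr (hseg ht)
  let p : ℝ → Ω → ℝ := fun s => invDist (F + s • (G - F))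
  let φ : ℝ → Ω → ℝ := fun s m => ∑ k, ∑ l with l ≠ k, (G k l - F k l) * (p s k * Z k l m)
  -- The perturbation formula is exact, so the difference quotient at `t` is `φ s m`.
  -- Differentiability thus reduces to continuity at `t`, which follows from boundedness of `φ`.
  have hdiff : ∀ s ∈ Set.Icc (0 : ℝ) 1, ∀ m, p s m - p t m = (s - t) * φ s m := by
    intro s hs m
    refine (hpert _ (hseg hs) m).trans ?_
    simp only [φ, Finset.mul_sum]
    refine Finset.sum_congr rfl fun k _ => Finset.sum_congr rfl fun l _ => ?_
    simp only [Matrix.add_apply, Matrix.smul_apply, Matrix.sub_apply, smul_eq_mul, p]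
    ring
  have hcont : ∀ m, ContinuousWithinAt (fun s => p s m) (Set.Icc 0 1) t := by
    intro m
    let C := ∑ k, ∑ l with l ≠ k, |G k l - F k l| * |Z k l m|
    have hC : ∀ s ∈ Set.Icc (0 : ℝ) 1, |φ s m| ≤ C := by
      intro s hs
      refine (Finset.abs_sum_le_sum_abs _ _).trans (Finset.sum_le_sum fun k _ =>
        (Finset.abs_sum_le_sum_abs _ _).trans (Finset.sum_le_sum fun l _ => ?_))
      have hirr' := isIrreducible_of_le hirr (hseg hs).2
      rw [abs_mul, abs_mul, abs_of_pos (invDist_pos (hseg hs).1 hirr' k)]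
      exact mul_le_mul_of_nonneg_left
        (mul_le_of_le_one_left (abs_nonneg _) (invDist_le_one (hseg hs).1 hirr' k)) (abs_nonneg _)
    have hlim : Filter.Tendsto (fun s => |s - t| * C) (nhdsWithin t (Set.Icc 0 1)) (nhds 0) := by
      have : Continuous fun s : ℝ => |s - t| * C := by fun_prop
      simpa using (this.tendsto t).mono_left nhdsWithin_le_nhds
    rw [ContinuousWithinAt, tendsto_iff_norm_sub_tendsto_zero]
    refine squeeze_zero' (Filter.Eventually.of_forall fun s => norm_nonneg _) ?_ hlim
    filter_upwards [self_mem_nhdsWithin] with s hs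
    rw [hdiff s hs m, Real.norm_eq_abs, abs_mul]
    exact mul_le_mul_of_nonneg_left (hC s hs) (abs_nonneg _)
  have hφ : ContinuousWithinAt (fun s => φ s m) (Set.Icc 0 1) t := by
    simp only [φ]
    refine tendsto_finsetSum _ fun k _ => tendsto_finsetSum _ fun l _ => ?_
    exact ((hcont k).mul continuousWithinAt_const).const_mul _
  refine ⟨φ t m, ?_, ?_⟩
  · rw [hasDerivWithinAt_iff_tendsto_slope]
    refine (hφ.tendsto.mono_left (nhdsWithin_mono _ Set.sdiff_subset)).congr' ?_
    filter_upwards [self_mem_nhdsWithin] with s hs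
    have hst : s - t ≠ 0 := sub_ne_zero.2 hs.2
    have := hdiff s hs.1 m
    simp only [p] at this
    rw [slope_def_field, this, mul_div_cancel_left₀ _ hst]
  · refine (Finset.abs_sum_le_sum_abs _ _).trans ?_
    rw [Finset.mul_sum]
    refine Finset.sum_le_sum fun k _ => (Finset.abs_sum_le_sum_abs _ _).trans ?_
    rw [Finset.mul_sum]
    refine Finset.sum_le_sum fun l hl => ?_
    rw [abs_mul, mul_left_comm]
    exact mul_le_mul_of_nonneg_left (hZ k l (Finset.mem_filter.1 hl).2 m) (abs_nonneg _)

/-- The derivative estimate, divided by the `invDist` entry, is integrated along the segment by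
comparison with an explicit antiderivative `B` of the bound. -/
theorem logBound_Q (hS : IsSubstochastic S) (hirr : S.IsIrreducible) :
    LogBound S (fun i j => Q S hS i j) := by
  intro F G hF hG m
  have : Nonempty Ω := ⟨m⟩
  have hpos : ∀ t ∈ Set.Icc (0 : ℝ) 1, 0 < invDist (F + t • (G - F)) m := fun t ht =>
    invDist_pos (hF.segment hG ht).1 (isIrreducible_of_le hirr (hF.segment hG ht).2) m
  let x : ℝ → Ω → Ω → ℝ := fun t k l => (F + t • (G - F)) k l - S k l + Q S hS k l
  have hx : ∀ t ∈ Set.Icc (0 : ℝ) 1, ∀ k l, l ≠ k → 0 < x t k l := fun t ht k l hlk => by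
    have h1 := (hF.segment hG ht).2 k l
    have h2 := Q_pos hS hirr hlk.symm
    simp only [x]
    linarith
  have hxd : ∀ t k l, HasDerivAt (fun s => x s k l) (G k l - F k l) t := by
    intro t k l
    have : (fun s => x s k l) = fun s => s * (G k l - F k l) + (F k l - S k l + Q S hS k l) := by
      funext s
      simp only [x, Matrix.add_apply, Matrix.smul_apply, Matrix.sub_apply, smul_eq_mul]
      ring
    rw [this]
    simpa using ((hasDerivAt_id t).mul_const (G k l - F k l)).add_const
      (F k l - S k l + Q S hS k l)
  -- Each `x t k l` is affine in `t`, so it moves in a fixed direction; the sign turns `log` into an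
  -- antiderivative of `|G k l - F k l| * (x t k l)⁻¹`.
  let σ : Ω → Ω → ℝ := fun k l => (SignType.sign (G k l - F k l) : ℝ)
  let B : ℝ → ℝ := fun t => ∑ k, ∑ l with l ≠ k, σ k l * (Real.log (x t k l) - Real.log (x 0 k l))
  let B' : ℝ → ℝ := fun t => ∑ k, ∑ l with l ≠ k, |G k l - F k l| * (x t k l)⁻¹
  have hBd : ∀ t ∈ Set.Icc (0 : ℝ) 1, HasDerivAt B (B' t) t := by
    intro t ht
    refine HasDerivAt.fun_sum fun k _ => HasDerivAt.fun_sum fun l hl => ?_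
    have h := (((hxd t k l).log (hx t ht k l (Finset.mem_filter.1 hl).2).ne').sub_const
      (Real.log (x 0 k l))).const_mul (σ k l)
    refine h.congr_deriv ?_
    rw [div_eq_mul_inv, ← mul_assoc, sign_mul_self]
  choose! d hd hdle using fun t ht => exists_hasDerivWithinAt_invDist hS hirr hF hG (t := t) ht m
  have hfd : ∀ t ∈ Set.Icc (0 : ℝ) 1, HasDerivWithinAt
      (fun s => Real.log (invDist (F + s • (G - F)) m) - Real.log (invDist F m))
      (d t / invDist (F + t • (G - F)) m) (Set.Icc 0 1) t := fun t ht =>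
    ((hd t ht).log (hpos t ht).ne').sub_const _
  have hfence := image_norm_le_of_norm_deriv_right_le_deriv_boundary' (a := 0) (b := 1) (B := B)
    (B' := B') (fun t ht => (hfd t ht).continuousWithinAt)
    (fun t ht => (hfd t ⟨ht.1, ht.2.le⟩).mono_of_mem_nhdsWithin (Icc_mem_nhdsGE_of_mem ht))
    (by simp [B])
    (fun t ht => (hBd t ht).continuousAt.continuousWithinAt)
    (fun t ht => (hBd t ⟨ht.1, ht.2.le⟩).hasDerivWithinAt)
    (fun t ht => by
      have ht' : t ∈ Set.Icc (0 : ℝ) 1 := ⟨ht.1, ht.2.le⟩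
      rw [Real.norm_eq_abs, abs_div, abs_of_pos (hpos t ht'), div_le_iff₀ (hpos t ht'), mul_comm]
      exact hdle t ht') (Set.right_mem_Icc.2 zero_le_one)
  simp only [one_smul, add_sub_cancel, Real.norm_eq_abs, B, x, zero_smul, add_zero] at hfence
  refine hfence.trans (Finset.sum_le_sum fun k _ => Finset.sum_le_sum fun l _ => ?_)
  refine (le_abs_self _).trans ?_
  rw [abs_mul]
  refine mul_le_of_le_one_left (abs_nonneg _) ?_
  simp only [σ]
  rcases lt_trichotomy (G k l - F k l) 0 with h | h | h
  · simp [sign_neg h]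
  · simp [h]
  · simp [sign_pos h]

lemma abs_log_sub_log_le {r x y : ℝ} (hr : 0 < r) (hx : 0 ≤ x) (hy : 0 ≤ y) :
    |Real.log (y + r) - Real.log (x + r)| ≤ r⁻¹ * |y - x| := by
  have key : ∀ {u v : ℝ}, 0 ≤ u → 0 ≤ v →
      Real.log (v + r) - Real.log (u + r) ≤ r⁻¹ * |v - u| := by
    intro u v hu hv
    have hur : 0 < u + r := by linarith
    have hvr : 0 < v + r := by linarith
    rw [← Real.log_div hvr.ne' hur.ne']
    refine (Real.log_le_sub_one_of_pos (div_pos hvr hur)).trans ?_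
    have e : (v + r) / (u + r) - 1 = (u + r)⁻¹ * (v - u) := by
      field_simp
      ring
    rw [e]
    exact (mul_le_mul_of_nonneg_left (le_abs_self _) (inv_pos.2 hur).le).trans
      (mul_le_mul_of_nonneg_right (inv_anti₀ hr (by linarith)) (abs_nonneg _))
  rw [abs_le]
  have h1 := key hx hy
  have h2 := key hy hx
  rw [abs_sub_comm] at h2
  constructor <;> linarith

theorem linearBound_Q (hS : IsSubstochastic S) (hirr : S.IsIrreducible) :
    LinearBound S (fun i j => (Q S hS i j)⁻¹) := by
  intro F G hF hG m
  refine (logBound_Q hS hirr F G hF hG m).trans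
    (Finset.sum_le_sum fun k _ => Finset.sum_le_sum fun l hl => ?_)
  have h := abs_log_sub_log_le (Q_pos hS hirr (Finset.mem_filter.1 hl).2.symm)
    (sub_nonneg.2 (hF.2 k l)) (sub_nonneg.2 (hG.2 k l))
  rwa [sub_sub_sub_cancel_right] at h

/-! ### Optimality -/

/-- The chain that returns to `i` instead of being killed. -/
def returnTo (S : Matrix Ω Ω ℝ) (i : Ω) : Matrix Ω Ω ℝ :=
  Matrix.of fun a b => S a b + if b = i then 1 - ∑ c, S a c else 0

lemma returnTo_isStochasticAbove (hS : IsSubstochastic S) (i : Ω) :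
    IsStochasticAbove S (returnTo S i) := by
  have hle : ∀ a b, S a b ≤ returnTo S i a b := fun a b => by
    simp only [returnTo, Matrix.of_apply]
    split_ifs
    · linarith [hS.2 a]
    · linarith
  refine ⟨Matrix.mem_rowStochastic_iff_sum.2 ⟨fun a b => (hS.1 a b).trans (hle a b), fun a => ?_⟩,
    hle⟩
  simp [returnTo, Finset.sum_add_distrib]

/-- Two states are visited in proportion to the hitting probabilities between them. -/
lemma invDist_mul_sum_eq [Nonempty Ω] (hF : F ∈ Matrix.rowStochastic ℝ Ω) (hirr : F.IsIrreducible)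
    {i j : Ω} (hij : i ≠ j) {h : Ω → ℝ} (hi : h i = 0) (hj : h j = 1)
    (hh : ∀ a, a ≠ i → a ≠ j → h a = ∑ b, F a b * h b) :
    invDist F i * ∑ b, F i b * h b = invDist F j * (1 - ∑ b, F j b * h b) := by
  obtain ⟨h1, -⟩ := invDist_spec hF hirr
  -- Stationarity makes the mean of `h - F h` vanish; by harmonicity only the terms at `i` and `j`
  -- contribute.
  have e : ∑ a, invDist F a * (h a - ∑ b, F a b * h b) = 0 := by
    simp only [mul_sub, Finset.sum_sub_distrib, Finset.mul_sum]
    rw [Finset.sum_comm, sub_eq_zero]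
    refine Finset.sum_congr rfl fun b _ => ?_
    have := congrFun h1 b
    simp only [Matrix.vecMul, dotProduct] at this
    rw [← this, Finset.sum_mul]
    simp only [mul_assoc]
  have e2 : ∑ a ∈ {i, j}, invDist F a * (h a - ∑ b, F a b * h b) = 0 := by
    rw [← e]
    refine Finset.sum_subset (Finset.subset_univ _) fun a _ ha => ?_
    simp only [Finset.mem_insert, Finset.mem_singleton, not_or] at ha
    rw [← hh a ha.1 ha.2, sub_self, mul_zero]
  rw [Finset.sum_pair hij, hi, hj] at e2
  linarith

/-- The chosen pair changes only the escape probability from `i` to `j`, from `Q` to `Q + t`, and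
leaves the return behaviour from `j` untouched. The ratio of the two masses is then known
explicitly. -/
lemma exists_sharp (hS : IsSubstochastic S) (hirr : S.IsIrreducible) {i j : Ω} (hij : i ≠ j)
    {ε : ℝ} (hε : 0 < ε) :
    ∃ F G : Matrix Ω Ω ℝ, IsStochasticAbove S F ∧ IsStochasticAbove S G ∧
      (∀ k l, (k, l) ≠ (i, j) → (k, l) ≠ (i, i) → G k l = F k l) ∧
      (∑ m, S i m < 1 → G i j ≠ F i j) ∧
      ∃ m, 1 / 2 * (Q S hS i j + ε)⁻¹ * |G i j - F i j| ≤
        |Real.log (invDist G m) - Real.log (invDist F m)| := by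
  have : Nonempty Ω := ⟨i⟩
  have hcl := closedSetsTrivial_of_isIrreducible hirr
  obtain ⟨h, hh⟩ := exists_isHittingProb hS hcl hij
  have hQ := Q_eq_sum hS hcl hij hh
  have hQ0 := Q_pos hS hirr hij
  -- `t ≤ ε` gives the estimate with `Q + ε`; `t` at most the deficit of row `i` keeps `G ≥ S`, and
  -- `t > 0` when the deficit is positive.
  let t := min ε (1 - ∑ c, S i c)
  have ht0 : 0 ≤ t := le_min hε.le (sub_nonneg.2 (hS.2 i))
  let F := returnTo S i
  let G : Matrix Ω Ω ℝ := Matrix.of fun a b =>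
    F a b + (if a = i then if b = j then t else if b = i then -t else 0 else 0)
  have hF : IsStochasticAbove S F := returnTo_isStochasticAbove hS i
  have hFsum := (Matrix.mem_rowStochastic_iff_sum.1 hF.1).2
  have hGle : ∀ a b, S a b ≤ G a b := by
    intro a b
    have h1 := hF.2 a b
    have h2 : t ≤ 1 - ∑ c, S i c := min_le_right _ _
    simp only [G, Matrix.of_apply]
    split_ifs with ha hb hb
    · linarith
    · subst ha hb
      simp only [F, returnTo, Matrix.of_apply, if_true]
      linarith
    · linarith
    · linarith
  have hrow : ∀ f : Ω → ℝ, ∑ b, G i b * f b = ∑ b, F i b * f b + t * (f j - f i) := by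
    intro f
    have e : ∀ b, G i b * f b = F i b * f b + ((if b = j then t * f b else 0) -
        if b = i then t * f b else 0) := by
      intro b
      simp only [G, Matrix.of_apply, if_true]
      by_cases hbj : b = j
      · subst hbj
        simp only [if_true, hij.symm, if_false]
        ring
      · by_cases hbi : b = i
        · subst hbi
          simp only [if_true, hij, if_false]
          ring
        · simp only [hbj, hbi, if_false]
          ring
    simp only [e, Finset.sum_add_distrib, Finset.sum_sub_distrib, Finset.sum_ite_eq',
      Finset.mem_univ, if_true]
    ring
  have hother : ∀ a, a ≠ i → G a = F a := by
    intro a ha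
    funext b
    simp [G, ha]
  have hG : IsStochasticAbove S G := by
    refine ⟨Matrix.mem_rowStochastic_iff_sum.2
      ⟨fun a b => (hS.1 a b).trans (hGle a b), fun a => ?_⟩, hGle⟩
    by_cases ha : a = i
    · subst ha
      have := hrow fun _ => 1
      simp only [mul_one, sub_self, mul_zero, add_zero, hFsum] at this
      exact this
    · rw [hother a ha, hFsum]
  have hGF : G i j - F i j = t := by simp [G]
  -- The mass returned to `i` is invisible to `h`, since `h i = 0`; so `h` remains harmonic for `F`.
  have hFh : ∀ a, ∑ b, F a b * h b = ∑ b, S a b * h b := by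
    intro a
    simp [F, returnTo, add_mul, Finset.sum_add_distrib, hh.left]
  have hFharm : ∀ a, a ≠ i → a ≠ j → h a = ∑ b, F a b * h b := fun a hai haj => by
    rw [hFh, ← hh.harmonic a hai haj]
  have eF := invDist_mul_sum_eq hF.1 (isIrreducible_of_le hirr hF.2) hij hh.left hh.right hFharm
  have eG := invDist_mul_sum_eq hG.1 (isIrreducible_of_le hirr hG.2) hij hh.left hh.right
    (fun a hai haj => by rw [hother a hai]; exact hFharm a hai haj)
  rw [hFh, ← hQ] at eF
  rw [hrow, hFh, ← hQ, hh.left, hh.right, sub_zero, mul_one, hother j hij.symm] at eG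
  -- Row `j` is the same in `F` and `G`, so one constant `c` serves both balance identities and
  -- cancels in the ratio.
  set c := 1 - ∑ b, F j b * h b
  have hpF := invDist_pos hF.1 (isIrreducible_of_le hirr hF.2)
  have hpG := invDist_pos hG.1 (isIrreducible_of_le hirr hG.2)
  have hc : 0 < c := by
    have : 0 < invDist F j * c := eF ▸ mul_pos (hpF i) hQ0
    exact pos_of_mul_pos_right this (hpF j).le
  have lF : Real.log (invDist F i) + Real.log (Q S hS i j) =
      Real.log (invDist F j) + Real.log c := by
    rw [← Real.log_mul (hpF i).ne' hQ0.ne', eF, Real.log_mul (hpF j).ne' hc.ne']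
  have hQt : 0 < Q S hS i j + t := by linarith
  have lG : Real.log (invDist G i) + Real.log (Q S hS i j + t) =
      Real.log (invDist G j) + Real.log c := by
    rw [← Real.log_mul (hpG i).ne' hQt.ne', eG, Real.log_mul (hpG j).ne' hc.ne']
  have hlog : (Q S hS i j + ε)⁻¹ * t ≤ Real.log (Q S hS i j + t) - Real.log (Q S hS i j) := by
    have h1 := Real.log_le_sub_one_of_pos (div_pos hQ0 hQt)
    rw [Real.log_div hQ0.ne' hQt.ne'] at h1
    have e : Q S hS i j / (Q S hS i j + t) - 1 = -((Q S hS i j + t)⁻¹ * t) := by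
      field_simp
      ring
    have h2 : (Q S hS i j + ε)⁻¹ * t ≤ (Q S hS i j + t)⁻¹ * t :=
      mul_le_mul_of_nonneg_right (inv_anti₀ hQt (by linarith [min_le_left ε (1 - ∑ c, S i c)])) ht0
    linarith
  refine ⟨F, G, hF, hG, fun k l h1 h2 => ?_, fun hlt heq => ?_, ?_⟩
  · by_cases hk : k = i
    · subst hk
      have hlj : l ≠ j := fun h => h1 (by rw [h])
      have hlk : l ≠ k := fun h => h2 (by rw [h])
      simp [G, hlj, hlk]
    · rw [hother k hk]
  · have : 0 < t := lt_min hε (sub_pos.2 hlt)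
    rw [heq, sub_self] at hGF
    exact this.ne hGF
  · rw [hGF, abs_of_nonneg ht0]
    -- If the log-masses at `i` and `j` both moved by less than half of `(Q + ε)⁻¹ * t`, their
    -- difference could not move by the full amount.
    by_contra hno
    push Not at hno
    have h1 := hno i
    have h2 := hno j
    rw [abs_lt] at h1 h2
    linarith [h1.1, h2.2]

/-- If two stochastic matrices differ only in the entries `(i, j)` and `(i, i)`, then at most one
off-diagonal summand is nonzero. -/
lemma sum_offDiag_eq_single {i j : Ω} (hij : i ≠ j) (f : Ω → Ω → ℝ)
    (hf : ∀ k l, (k, l) ≠ (i, j) → (k, l) ≠ (i, i) → f k l = 0) :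
    ∑ k, ∑ l with l ≠ k, f k l = f i j := by
  rw [Finset.sum_eq_single i, Finset.sum_eq_single j]
  · intro l hl hlj
    exact hf i l (by simp [hlj]) (by simpa using hl)
  · simp [hij.symm]
  · intro k _ hki
    exact Finset.sum_eq_zero fun l _ => hf k l (by simp [hki]) (by simp [hki])
  · simp

end ErrorBounds

end MarkovPerturbation

theorem mainTheorem5 {Ω : Type*} [Fintype Ω] [DecidableEq Ω] (S : Matrix Ω Ω ℝ)
    (hS : IsSubstochastic S) (hirr : S.IsIrreducible) :
    (∀ i j : Ω, i ≠ j → ∀ ε : ℝ, 0 < ε →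
      ∃ F G : Matrix Ω Ω ℝ, IsStochasticAbove S F ∧ IsStochasticAbove S G ∧
        (∀ k l, (k, l) ≠ (i, j) → (k, l) ≠ (i, i) → |G k l - F k l| = 0) ∧
        (∑ m, S i m < 1 → G i j ≠ F i j) ∧
        Finset.univ.sup' ⟨i, Finset.mem_univ i⟩
            (fun m => |Real.log (invDist G m) - Real.log (invDist F m)|) ≥
          1 / 2 * (Q S hS i j + ε)⁻¹ * |G i j - F i j| ∧
        1 / 2 * (Q S hS i j + ε)⁻¹ * |G i j - F i j| ≥
          |Real.log (G i j - S i j + 2 * (Q S hS i j + ε)) -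
            Real.log (F i j - S i j + 2 * (Q S hS i j + ε))|) ∧
    (∀ i j : Ω, i ≠ j → 0 < Q S hS i j) ∧
    LogBound S (fun i j => Q S hS i j) ∧
    LinearBound S (fun i j => (Q S hS i j)⁻¹) ∧
    (∀ i j : Ω, i ≠ j → ∑ m, S i m < 1 →
      (∀ ρ : Matrix Ω Ω ℝ, (∀ k l, k ≠ l → 0 < ρ k l) → LogBound S ρ →
        ρ i j ≤ 2 * Q S hS i j) ∧
      (∀ η : Matrix Ω Ω ℝ, LinearBound S η → 1 / 2 * (Q S hS i j)⁻¹ ≤ η i j)) := by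


  refine ⟨fun i j hij ε hε => ?_, fun i j hij => Q_pos hS hirr hij, logBound_Q hS hirr,
    linearBound_Q hS hirr, fun i j hij hlt => ⟨fun ρ hρ hb => ?_, fun η hb => ?_⟩⟩
  · obtain ⟨F, G, hF, hG, h1, h2, m, hm⟩ := exists_sharp hS hirr hij hε
    refine ⟨F, G, hF, hG, fun k l hk hl => by simp [h1 k l hk hl], h2, ?_, ?_⟩
    · exact hm.trans (Finset.le_sup'
        (fun m => |Real.log (invDist G m) - Real.log (invDist F m)|) (Finset.mem_univ m))
    · have hQ := Q_pos hS hirr hij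
      -- With this `r`, the Lipschitz constant `r⁻¹` of the shifted logarithm is exactly the
      -- required coefficient.
      have h := abs_log_sub_log_le (r := 2 * (Q S hS i j + ε)) (by linarith)
        (sub_nonneg.2 (hF.2 i j)) (sub_nonneg.2 (hG.2 i j))
      rw [sub_sub_sub_cancel_right, mul_inv] at h
      rwa [one_div]
  · have hQ := Q_pos hS hirr hij
    have hρ0 := hρ i j hij
    refine le_of_forall_pos_le_add fun ε hε => ?_
    -- Half of `ε` is used because the factor two turns `Q + ε / 2` into `2 * Q + ε`.
    obtain ⟨F, G, hF, hG, h1, h2, m, hm⟩ := exists_sharp hS hirr hij (half_pos hε)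
    have h3 := hm.trans (hb F G hF hG m)
    rw [sum_offDiag_eq_single hij _ fun k l hk hl => by simp [h1 k l hk hl]] at h3
    have h4 := abs_log_sub_log_le hρ0 (sub_nonneg.2 (hF.2 i j)) (sub_nonneg.2 (hG.2 i j))
    rw [sub_sub_sub_cancel_right] at h4
    have h5 := le_of_mul_le_mul_right (h3.trans h4) (abs_pos.2 (sub_ne_zero.2 (h2 hlt)))
    have h6 : (2 * Q S hS i j + ε)⁻¹ ≤ (ρ i j)⁻¹ := by
      refine le_trans (le_of_eq ?_) h5
      rw [one_div, ← mul_inv]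
      congr 1
      ring
    exact (inv_le_inv₀ (by linarith) hρ0).1 h6
  · have hQ := Q_pos hS hirr hij
    have key : ∀ ε, 0 < ε → 1 / 2 * (Q S hS i j + ε)⁻¹ ≤ η i j := by
      intro ε hε
      obtain ⟨F, G, hF, hG, h1, h2, m, hm⟩ := exists_sharp hS hirr hij hε
      have h3 := hm.trans (hb F G hF hG m)
      rw [sum_offDiag_eq_single hij _ fun k l hk hl => by simp [h1 k l hk hl]] at h3
      -- The row deficit makes the perturbation nonzero, so it can be cancelled; no sign of `η` is
      -- needed.
      exact le_of_mul_le_mul_right h3 (abs_pos.2 (sub_ne_zero.2 (h2 hlt)))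
    have hlim : Filter.Tendsto (fun ε => 1 / 2 * (Q S hS i j + ε)⁻¹) (nhdsWithin 0 (Set.Ioi 0))
        (nhds (1 / 2 * (Q S hS i j + 0)⁻¹)) := by
      refine Filter.Tendsto.mono_left ?_ nhdsWithin_le_nhds
      exact ((tendsto_const_nhds.add Filter.tendsto_id).inv₀ (by simpa using hQ.ne')).const_mul _
    rw [add_zero] at hlim
    exact le_of_tendsto hlim (Filter.eventually_of_mem self_mem_nhdsWithin key)
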